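/- Let $H$ be a complex Hilbert space with two orthonormal bases $\{e_i\}_{i\in\Theta}$ and $\{f_i\}_{i\in\Theta}$ indexed by the same set $\Theta$, and let $(\omega_i)_{i\in\Theta}$ be positive real numbers with $\sum_{i\in\Theta}\omega_i=1$. Let $\mathcal F(H)=\bigoplus_{n\ge 0}H^{\otimes n}$ be the full Fock space ($H^{\otimes 0}=\mathbb C\Omega$), and for $\xi\in H$ let $l_\xi\in B(\mathcal F(H))$ be the left creation operator $l_\xi(\eta)=\xi\otimes\eta$. Consider the normal unital completely positive maps on $B(\mathcal F(H))$ $$P_\omega(x)=\sum_{i\in\Theta}\omega_i\, l_{e_i}^*\,x\,l_{e_i},\qquad P'_\omega(x)=\sum_{i\in\Theta}\omega_i\, l_{f_i}^*\,x\,l_{f_i}.$$ For a normal unital completely positive map $\tau$ on $B(K)$, $K$ a Hilbert space, the peripheral Poisson boundary $P(\tau)$ is the norm-closed linear span of all $x\in B(K)$ with $\tau(x)=\lambda x$ for some $\lambda\in\mathbb C$, $|\lambda|=1$. It is a unital C*-algebra for the norm, the unit and the adjoint of $B(K)$ and the modified Choi–Effros product $\circ$, the unique norm-continuous bilinear product on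 $P(\tau)$ such that $x\circ y=\text{SOT-}\lim_{n\to\infty}(\lambda\mu)^{-n}\tau^n(xy)$ whenever $\tau(x)=\lambda x$, $\tau(y)=\mu y$ and $|\lambda|=|\mu|=1$. Let $U:H\to H$ be the unitary with $Ue_i=f_i$ for all $i\in\Theta$, let $\Gamma_U$ be its second quantization, i.e. the unitary of $\mathcal F(H)$ with $\Gamma_U\Omega=\Omega$ and $\Gamma_U|_{H^{\otimes n}}=U^{\otimes n}$ for $n\ge1$, and let $\widetilde\Gamma_U$ be the automorphism $x\mapsto\Gamma_U\,x\,\Gamma_U^*$ of $B(\mathcal F(H))$. Then $$\widetilde\Gamma_U\circ P_\omega=P'_\omega\circ\widetilde\Gamma_U ,$$ where $\circ$ denotes composition of maps, and $\widetilde\Gamma_U$ restricts to a $*$-isomorphism from the C*-algebra $P(P_\omega)$ onto the C*-algebra $P(P'_\omega)$. -/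

import Mathlib

noncomputable section

namespace PeripheralPoisson

open scoped CStarAlgebra InnerProductSpace ComplexOrder Topology
open Filter ContinuousLinearMap

universe u v

/-! ### Normal unital completely positive maps -/

/-- A normal unital completely positive map on `B(K)`: completely positive, unital, and preserving
suprema of (bounded) upward directed sets of self-adjoint operators in the Loewner order. -/
structure NormalUCPMap (K : Type u) [NormedAddCommGroup K] [InnerProductSpace ℂ K]
    [CompleteSpace K] extends CompletelyPositiveMap (K →L[ℂ] K) (K →L[ℂ] K) where
  map_one' : toFun 1 = 1
  normal' : ∀ S : Set (K →L[ℂ] K), S.Nonempty → DirectedOn (· ≤ ·) S →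
    (∀ s ∈ S, IsSelfAdjoint s) → ∀ a, IsLUB S a → IsLUB (toFun '' S) (toFun a)

section Basic

set_option linter.unusedSectionVars false

variable {K : Type u} [NormedAddCommGroup K] [InnerProductSpace ℂ K] [CompleteSpace K]

/-- Positivity of the diagonal entries of a positive matrix over a C⋆-algebra. -/
lemma entry_nonneg {n : ℕ} (M : CStarMatrix (Fin n) (Fin n) (K →L[ℂ] K)) (hM : 0 ≤ M) (i : Fin n) :
    0 ≤ M i i := by
  rw [StarOrderedRing.nonneg_iff] at hM
  induction hM using AddSubmonoid.closure_induction with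
  | mem M hM =>
    obtain ⟨N, rfl⟩ := hM
    dsimp only
    rw [CStarMatrix.mul_apply]
    refine Finset.sum_nonneg fun j _ => ?_
    rw [CStarMatrix.star_apply]
    exact star_mul_self_nonneg _
  | zero => exact le_rfl
  | add M N _ _ h1 h2 => exact add_nonneg h1 h2

lemma sq_norm_apply_le {b : K →L[ℂ] K} (hb : 0 ≤ b) (h : K) :
    ‖b h‖ ^ 2 ≤ ‖b‖ * RCLike.re ⟪b h, h⟫_ℂ := by
  obtain ⟨c, hc⟩ := CStarAlgebra.nonneg_iff_eq_star_mul_self.mp hb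
  have h1 : ‖b‖ = ‖c‖ ^ 2 := by rw [hc, CStarRing.norm_star_mul_self, sq]
  have h2 : RCLike.re ⟪b h, h⟫_ℂ = ‖c h‖ ^ 2 := by
    have : ⟪(star c * c) h, h⟫_ℂ = ⟪c h, c h⟫_ℂ := adjoint_inner_left c h (c h)
    rw [hc, this, inner_self_eq_norm_sq]
  have h3 : b h = (star c) (c h) := by rw [hc]; rfl
  rw [h1, h2, h3, ← mul_pow]
  gcongr
  calc _ ≤ ‖star c‖ * ‖c h‖ := le_opNorm _ _
    _ = _ := by rw [norm_star]

lemma nonneg_of_tendsto {ι : Type*} {l : Filter ι} [l.NeBot] (d : ι → K →L[ℂ] K) (D : K →L[ℂ] K)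
    (hd : ∀ h, Tendsto (fun i => d i h) l (𝓝 (D h))) (hd0 : ∀ᶠ i in l, 0 ≤ d i) : 0 ≤ D := by
  rw [nonneg_iff_isPositive, isPositive_iff_complex]
  intro x
  have ht : Tendsto (fun i => ⟪d i x, x⟫_ℂ) l (𝓝 ⟪D x, x⟫_ℂ) :=
    (hd x).inner tendsto_const_nhds
  have h0 : 0 ≤ ⟪D x, x⟫_ℂ := by
    refine ge_of_tendsto ht (hd0.mono fun i hi => ?_)
    exact ((nonneg_iff_isPositive _).mp hi).inner_nonneg_left x
  have h1 := Complex.nonneg_iff.mp h0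
  exact ⟨Complex.ext rfl (by simpa using h1.2), h1.1⟩

lemma lt_of_sq_le_mul {p q r M N : ℝ} (hM : 0 ≤ M) (hN : N ≤ M) (hp : p ^ 2 ≤ N * r) (hr : 0 ≤ r)
    (hq : 0 < q) (h : r < q ^ 2 / (M + 1)) : p < q := by
  rw [lt_div_iff₀ (by positivity)] at h
  have h4 : p ^ 2 < q ^ 2 := by nlinarith
  exact lt_of_pow_lt_pow_left₀ 2 hq.le h4

lemma exists_tendsto_of_monotone {ι : Type*} [Preorder ι] [IsDirectedOrder ι] [Nonempty ι]
    (b : ι → K →L[ℂ] K) (hb : Monotone b) (c : K →L[ℂ] K) (hc : ∀ i, b i ≤ c) (i₀ : ι) (h : K) :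
    ∃ y, Tendsto (fun i => b i h) atTop (𝓝 y) := by
  have hsub : ∀ i j, RCLike.re ⟪(b j - b i) h, h⟫_ℂ
      = RCLike.re ⟪b j h, h⟫_ℂ - RCLike.re ⟪b i h, h⟫_ℂ := fun i j => by
    rw [sub_apply, inner_sub_left, map_sub]
  have hle : ∀ x y : K →L[ℂ] K, x ≤ y → RCLike.re ⟪x h, h⟫_ℂ ≤ RCLike.re ⟪y h, h⟫_ℂ :=
    fun x y hxy => by
      have := ((le_def _ _).mp hxy).re_inner_nonneg_left h
      rw [sub_apply, inner_sub_left, map_sub] at this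
      linarith
  have hre : Tendsto (fun i => RCLike.re ⟪b i h, h⟫_ℂ) atTop
      (𝓝 (⨆ i, RCLike.re ⟪b i h, h⟫_ℂ)) :=
    tendsto_atTop_ciSup (fun i j hij => hle _ _ (hb hij))
      ⟨RCLike.re ⟪c h, h⟫_ℂ, by rintro _ ⟨i, rfl⟩; exact hle _ _ (hc i)⟩
  obtain ⟨M, hM0, hnorm⟩ : ∃ M : ℝ, 0 ≤ M ∧ ∀ i j, i₀ ≤ i → i ≤ j → ‖b j - b i‖ ≤ M :=
    ⟨‖c - b i₀‖, norm_nonneg _, fun i j hi hj =>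
      CStarAlgebra.norm_le_norm_of_nonneg_of_le (sub_nonneg.mpr (hb hj))
        (sub_le_sub (hc j) (hb hi))⟩
  refine cauchy_map_iff_exists_tendsto.mp (Metric.cauchy_iff.mpr ?_)
  refine ⟨inferInstance, fun ε hε => ?_⟩
  have hδ : 0 < (ε / 2) ^ 2 / (M + 1) := div_pos (pow_pos (half_pos hε) 2) (by linarith)
  have hev : ∀ᶠ i in atTop, dist (RCLike.re ⟪b i h, h⟫_ℂ) (⨆ i, RCLike.re ⟪b i h, h⟫_ℂ)
      < (ε / 2) ^ 2 / (M + 1) / 2 := Metric.tendsto_nhds.mp hre _ (half_pos hδ)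
  obtain ⟨i₁, hi₁⟩ := eventually_atTop.mp hev
  obtain ⟨i₂, h02, h12⟩ := exists_ge_ge i₀ i₁
  have key : ∀ j ≥ i₂, ‖b j h - b i₂ h‖ < ε / 2 := fun j hj => by
    have hp := sq_norm_apply_le (sub_nonneg.mpr (hb hj)) h
    have hn := hnorm i₂ j h02 hj
    have d1 := hi₁ j (h12.trans hj)
    have d2 := hi₁ i₂ h12
    have h3 : RCLike.re ⟪(b j - b i₂) h, h⟫_ℂ < (ε / 2) ^ 2 / (M + 1) := by
      rw [Real.dist_eq, abs_lt] at d1 d2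
      rw [hsub]
      linarith [d1.2, d2.1]
    have h0 : 0 ≤ RCLike.re ⟪(b j - b i₂) h, h⟫_ℂ :=
      ((le_def _ _).mp (hb hj)).re_inner_nonneg_left h
    exact lt_of_sq_le_mul hM0 hn hp h0 (half_pos hε) h3
  refine ⟨_, image_mem_map (Ici_mem_atTop i₂), ?_⟩
  rintro _ ⟨j, hj, rfl⟩ _ ⟨k, hk, rfl⟩
  calc dist (b j h) (b k h) ≤ dist (b j h) (b i₂ h) + dist (b k h) (b i₂ h) :=
        dist_triangle_right _ _ _
    _ < ε / 2 + ε / 2 := by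
        rw [dist_eq_norm, dist_eq_norm]; exact add_lt_add (key j hj) (key k hk)
    _ = ε := add_halves ε

/-- A bounded monotone net of operators converges strongly to its supremum. -/
theorem exists_lub_of_monotone {ι : Type*} [Preorder ι] [IsDirectedOrder ι] [Nonempty ι]
    (b : ι → K →L[ℂ] K) (hb : Monotone b) (c : K →L[ℂ] K) (hc : ∀ i, b i ≤ c) :
    ∃ L : K →L[ℂ] K, (∀ h, Tendsto (fun i => b i h) atTop (𝓝 (L h))) ∧ IsLUB (Set.range b) L := by
  have i₀ := Classical.arbitrary ι
  choose L hL using exists_tendsto_of_monotone b hb c hc i₀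
  have hbd : ∀ x, ‖L x‖ ≤ (‖c - b i₀‖ + ‖b i₀‖) * ‖x‖ := fun x => by
    refine le_of_tendsto (hL x).norm ?_
    filter_upwards [Ici_mem_atTop i₀] with i hi
    have h1 : ‖b i - b i₀‖ ≤ ‖c - b i₀‖ :=
      CStarAlgebra.norm_le_norm_of_nonneg_of_le (sub_nonneg.mpr (hb hi))
        (sub_le_sub_right (hc i) _)
    have h2 : ‖b i‖ ≤ ‖c - b i₀‖ + ‖b i₀‖ := by
      calc ‖b i‖ = ‖(b i - b i₀) + b i₀‖ := by rw [sub_add_cancel]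
        _ ≤ _ := (norm_add_le _ _).trans (by gcongr)
    exact (b i).le_of_opNorm_le h2 x
  let L' : K →L[ℂ] K := LinearMap.mkContinuous
    { toFun := L
      map_add' := fun x y => tendsto_nhds_unique (hL (x + y))
        (by simpa only [map_add] using (hL x).add (hL y))
      map_smul' := fun r x => tendsto_nhds_unique (hL (r • x))
        (by simpa only [map_smul, RingHom.id_apply] using (hL x).const_smul r) } _ hbd
  have hL' : ∀ h, Tendsto (fun i => b i h) atTop (𝓝 (L' h)) := hL
  clear_value L'
  refine ⟨L', hL', ?_, ?_⟩
  · rintro _ ⟨i, rfl⟩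
    refine sub_nonneg.mp (nonneg_of_tendsto (l := atTop) (fun j => b j - b i) _ (fun h => ?_) ?_)
    · exact (hL' h).sub tendsto_const_nhds
    · filter_upwards [Ici_mem_atTop i] with j hj
      exact sub_nonneg.mpr (hb hj)
  · intro c' hc'
    refine sub_nonneg.mp (nonneg_of_tendsto (l := atTop) (fun j => c' - b j) _ (fun h => ?_) ?_)
    · exact tendsto_const_nhds.sub (hL' h)
    · exact Eventually.of_forall fun j => sub_nonneg.mpr (hc' ⟨j, rfl⟩)

end Basic

namespace NormalUCPMap

variable {K : Type u} [NormedAddCommGroup K] [InnerProductSpace ℂ K] [CompleteSpace K]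

instance : FunLike (NormalUCPMap K) (K →L[ℂ] K) (K →L[ℂ] K) where
  coe τ := τ.toFun
  coe_injective := by
    rintro ⟨f, _, _⟩ ⟨g, _, _⟩ h
    congr
    exact DFunLike.coe_injective h

instance : LinearMapClass (NormalUCPMap K) ℂ (K →L[ℂ] K) (K →L[ℂ] K) where
  map_add τ := map_add τ.toLinearMap
  map_smulₛₗ τ := map_smulₛₗ τ.toLinearMap

instance : CompletelyPositiveMapClass (NormalUCPMap K) (K →L[ℂ] K) (K →L[ℂ] K) where
  map_cstarMatrix_nonneg' τ := τ.map_cstarMatrix_nonneg'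

variable (τ : NormalUCPMap K)

protected lemma map_one : τ 1 = 1 := τ.map_one'

lemma mono {a b : K →L[ℂ] K} (h : a ≤ b) : τ a ≤ τ b := OrderHomClass.mono τ h

lemma nonneg {a : K →L[ℂ] K} (h : 0 ≤ a) : 0 ≤ τ a := by simpa using τ.mono h

protected lemma map_star (a : K →L[ℂ] K) : τ (star a) = star (τ a) := by
  obtain ⟨y, hy, -, ha⟩ := CStarAlgebra.exists_sum_four_nonneg a
  conv_lhs => rw [ha]
  conv_rhs => rw [ha]
  simp only [star_sum, star_smul, map_sum, map_smul]
  refine Finset.sum_congr rfl fun i _ => ?_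
  rw [(IsSelfAdjoint.of_nonneg (hy i)).star_eq,
    (IsSelfAdjoint.of_nonneg (τ.nonneg (hy i))).star_eq]

/-- The Kadison--Schwarz inequality. -/
lemma schwarz (a : K →L[ℂ] K) : star (τ a) * τ a ≤ τ (star a * a) := by
  let N : CStarMatrix (Fin 2) (Fin 2) (K →L[ℂ] K) := CStarMatrix.ofMatrix !![1, a; 0, 0]
  have hM := τ.map_cstarMatrix_nonneg' 2 (star N * N)
    (star_mul_self_nonneg N)
  let N' : CStarMatrix (Fin 2) (Fin 2) (K →L[ℂ] K) := CStarMatrix.ofMatrix !![τ a, 0; -1, 0]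
  have h := entry_nonneg _ (star_left_conjugate_nonneg hM N') 0
  have e2 : ∀ x, τ.toLinearMap x = τ x := fun _ => rfl
  simp [CStarMatrix.mul_apply, CStarMatrix.star_apply, Fin.sum_univ_two, N, N', e2, τ.map_one,
    τ.map_star] at h
  exact h

lemma norm_le (a : K →L[ℂ] K) : ‖τ a‖ ≤ ‖a‖ := by
  have h1 : τ (star a * a) ≤ algebraMap ℝ _ (‖a‖ ^ 2) := by
    calc _ ≤ τ (algebraMap ℝ _ (‖a‖ ^ 2)) := τ.mono CStarAlgebra.star_mul_le_algebraMap_norm_sq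
      _ = _ := by
        rw [Algebra.algebraMap_eq_smul_one, ← Complex.coe_smul, map_smul, τ.map_one]
  have h2 := (CStarAlgebra.norm_le_iff_le_algebraMap (star (τ a) * τ a) (by positivity)
    (star_mul_self_nonneg _)).mpr ((τ.schwarz a).trans h1)
  rw [CStarRing.norm_star_mul_self, ← sq] at h2
  exact le_of_sq_le_sq h2 (by positivity)

/-- A normal ucp map as a bounded operator on the Banach space `B(K)`. -/
def toCLM : (K →L[ℂ] K) →L[ℂ] (K →L[ℂ] K) :=
  LinearMap.mkContinuous τ.toLinearMap 1 (fun a => by rw [one_mul]; exact τ.norm_le a)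

@[simp] lemma toCLM_apply (a : K →L[ℂ] K) : τ.toCLM a = τ a := rfl

end NormalUCPMap

section Peripheral

variable {K : Type u} [NormedAddCommGroup K] [InnerProductSpace ℂ K] [CompleteSpace K]
variable (τ : NormalUCPMap K)

/-- The eigenspace `E_z(τ) = {x | τ x = z x}`. -/
def eigenspace (z : ℂ) : Submodule ℂ (K →L[ℂ] K) where
  carrier := {x | τ x = z • x}
  add_mem' := fun {a b} ha hb => by
    rw [Set.mem_ofPred_eq] at *; rw [map_add, ha, hb, smul_add]
  zero_mem' := by simp
  smul_mem' := fun c x hx => by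
    rw [Set.mem_ofPred_eq] at *; rw [map_smul, hx, smul_comm]

lemma mem_eigenspace {z : ℂ} {x : K →L[ℂ] K} : x ∈ eigenspace τ z ↔ τ x = z • x := Iff.rfl

/-- `E(τ)`, the linear span of all eigenvectors for eigenvalues on the unit circle. -/
def peripheralSpan : Submodule ℂ (K →L[ℂ] K) :=
  Submodule.span ℂ {x | ∃ z : ℂ, ‖z‖ = 1 ∧ x ∈ eigenspace τ z}

/-- The operator space `P(τ)`, the norm closure of `E(τ)`. -/
def peripheralSpace : Submodule ℂ (K →L[ℂ] K) := (peripheralSpan τ).topologicalClosure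

lemma peripheralSpan_le : peripheralSpan τ ≤ peripheralSpace τ :=
  Submodule.le_topologicalClosure _

lemma eigenvector_mem {z : ℂ} (hz : ‖z‖ = 1) {x : K →L[ℂ] K} (hx : x ∈ eigenspace τ z) :
    x ∈ peripheralSpace τ :=
  peripheralSpan_le τ (Submodule.subset_span ⟨z, hz, hx⟩)

lemma isClosed_peripheralSpace : IsClosed (peripheralSpace τ : Set (K →L[ℂ] K)) :=
  Submodule.isClosed_topologicalClosure _

instance : CompleteSpace (peripheralSpace τ) :=
  (isClosed_peripheralSpace τ).completeSpace_coe

lemma peripheral_induction {p : peripheralSpace τ → Prop} (hc : IsClosed {x | p x})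
    (hadd : ∀ x y, p x → p y → p (x + y)) (hsmul : ∀ (c : ℂ) x, p x → p (c • x))
    (heig : ∀ (z : ℂ) (x : peripheralSpace τ), ‖z‖ = 1 → τ x = z • (x : K →L[ℂ] K) → p x) :
    ∀ x, p x := by
  have h0 : p 0 := heig 1 0 (by simp) (by simp)
  have hspan : ∀ x, x ∈ peripheralSpan τ → ∃ hx : x ∈ peripheralSpace τ, p ⟨x, hx⟩ := by
    intro x hx
    induction hx using Submodule.span_induction with
    | mem x hx =>
      obtain ⟨z, hz, hx⟩ := hx
      exact ⟨eigenvector_mem τ hz hx, heig z _ hz hx⟩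
    | zero => exact ⟨Submodule.zero_mem _, h0⟩
    | add x y _ _ hx hy =>
      obtain ⟨hx, hx'⟩ := hx
      obtain ⟨hy, hy'⟩ := hy
      exact ⟨Submodule.add_mem _ hx hy, hadd _ _ hx' hy'⟩
    | smul c x _ hx =>
      obtain ⟨hx, hx'⟩ := hx
      exact ⟨Submodule.smul_mem _ c hx, hsmul c _ hx'⟩
  rintro ⟨x, hx⟩
  obtain ⟨s, hs, hlim⟩ := mem_closure_iff_seq_limit.mp
    (show x ∈ closure (peripheralSpan τ : Set (K →L[ℂ] K)) from hx)
  choose hs1 hs2 using fun n => hspan (s n) (hs n)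
  exact hc.mem_of_tendsto (b := atTop) (f := fun n => ⟨s n, hs1 n⟩)
    (tendsto_subtype_rng.mpr hlim) (Eventually.of_forall hs2)

/-- Simultaneous recurrence of finitely many rotations. -/
lemma exists_recurrence {n : ℕ} (c : Fin n → ℂ) (hc : ∀ i, ‖c i‖ = 1) {ε : ℝ} (hε : 0 < ε) :
    ∃ m : ℕ, ∀ i, ‖c i ^ (m + 1) - 1‖ < ε := by
  let g : Fin n → Circle := fun i => ⟨c i, by simp [Submonoid.unitSphere, hc i]⟩
  obtain ⟨a, φ, hφ, ha⟩ := CompactSpace.tendsto_subseq (fun k : ℕ => g ^ k)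
  obtain ⟨N, hN⟩ := Metric.cauchySeq_iff.mp ha.cauchySeq ε hε
  have hlt : φ N < φ (N + 1) := hφ (Nat.lt_succ_self N)
  refine ⟨φ (N + 1) - φ N - 1, fun i => ?_⟩
  have h := (dist_le_pi_dist _ _ i).trans_lt (hN (N + 1) (Nat.le_succ N) N le_rfl)
  have h' : ‖c i ^ φ (N + 1) - c i ^ φ N‖ < ε := by
    rw [← dist_eq_norm]; exact h
  have e : φ (N + 1) = φ N + (φ (N + 1) - φ N - 1 + 1) := by omega
  rw [e, pow_add, ← mul_sub_one, norm_mul, norm_pow, hc i, one_pow, one_mul] at h'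
  exact h'

lemma pow_apply_of_eigen {z : ℂ} {x : K →L[ℂ] K} (hx : τ x = z • x) (n : ℕ) :
    (τ.toCLM ^ n) x = z ^ n • x := by
  induction n with
  | zero => simp
  | succ n ih =>
    rw [pow_succ]
    show (τ.toCLM ^ n) (τ x) = _
    rw [hx, map_smul, ih, smul_smul, pow_succ']

lemma norm_pow_apply_le (n : ℕ) (x : K →L[ℂ] K) : ‖(τ.toCLM ^ n) x‖ ≤ ‖x‖ := by
  induction n with
  | zero => simp
  | succ n ih =>
    rw [pow_succ']
    exact (τ.norm_le _).trans ih

/-- `τ` is isometric on `P(τ)`. -/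
lemma norm_apply_peripheral {x : K →L[ℂ] K} (hx : x ∈ peripheralSpace τ) : ‖τ x‖ = ‖x‖ := by
  refine le_antisymm (τ.norm_le x) ?_
  have hcl : IsClosed {x : K →L[ℂ] K | ‖x‖ ≤ ‖τ.toCLM x‖} :=
    isClosed_le continuous_norm (τ.toCLM.continuous.norm)
  refine closure_minimal (s := (peripheralSpan τ : Set (K →L[ℂ] K))) ?_ hcl hx
  intro x hx
  obtain ⟨n, f, g, rfl⟩ := Submodule.mem_span_set'.mp hx
  choose c hc hg using fun i => (g i).2
  set y := ∑ i, f i • (g i : K →L[ℂ] K) with hy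
  show ‖y‖ ≤ ‖τ.toCLM y‖
  refine le_of_forall_pos_le_add fun ε hε => ?_
  set S := ∑ i, ‖f i • (g i : K →L[ℂ] K)‖ with hS
  have hS0 : 0 ≤ S := Finset.sum_nonneg fun i _ => norm_nonneg _
  have hδ : 0 < ε / (S + 1) := by positivity
  obtain ⟨m, hm⟩ := exists_recurrence c hc hδ
  have h1 : (τ.toCLM ^ (m + 1)) y - y = ∑ i, (c i ^ (m + 1) - 1) • (f i • (g i : K →L[ℂ] K)) := by
    rw [hy, map_sum, ← Finset.sum_sub_distrib]
    refine Finset.sum_congr rfl fun i _ => ?_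
    rw [map_smul, pow_apply_of_eigen τ (hg i), sub_smul, one_smul, smul_comm]
  have h2 : ‖(τ.toCLM ^ (m + 1)) y - y‖ ≤ ε := by
    rw [h1]
    calc _ ≤ ∑ i, ε / (S + 1) * ‖f i • (g i : K →L[ℂ] K)‖ := by
          refine norm_sum_le_of_le _ fun i _ => ?_
          rw [norm_smul (c i ^ (m + 1) - 1)]
          exact mul_le_mul_of_nonneg_right (hm i).le (norm_nonneg _)
      _ = ε * (S / (S + 1)) := by rw [← Finset.mul_sum, ← hS]; ring
      _ ≤ ε * 1 := by
          refine mul_le_mul_of_nonneg_left ?_ hε.le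
          rw [div_le_one (by positivity)]; linarith
      _ = ε := mul_one ε
  have h3 : ‖(τ.toCLM ^ (m + 1)) y‖ ≤ ‖τ.toCLM y‖ := by
    rw [pow_succ]; exact norm_pow_apply_le τ m _
  calc ‖y‖ = ‖(τ.toCLM ^ (m + 1)) y - ((τ.toCLM ^ (m + 1)) y - y)‖ := by rw [sub_sub_cancel]
    _ ≤ ‖τ.toCLM y‖ + ε := (norm_sub_le _ _).trans (add_le_add h3 h2)

lemma apply_mem_peripheral (x : peripheralSpace τ) : τ x ∈ peripheralSpace τ := by
  refine peripheral_induction τ (p := fun x => τ x ∈ peripheralSpace τ) ?_ ?_ ?_ ?_ x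
  · exact (isClosed_peripheralSpace τ).preimage (τ.toCLM.continuous.comp continuous_subtype_val)
  · intro x y hx hy
    rw [Submodule.coe_add, map_add]; exact Submodule.add_mem _ hx hy
  · intro c x hx
    rw [Submodule.coe_smul, map_smul]; exact Submodule.smul_mem _ c hx
  · intro z x _ hx
    rw [hx]; exact Submodule.smul_mem _ z x.2

/-- The restriction of `τ` to `P(τ)`, as an isometric linear map. -/
def shiftIsometry : peripheralSpace τ →ₗᵢ[ℂ] peripheralSpace τ where
  toFun x := ⟨τ x, apply_mem_peripheral τ x⟩
  map_add' x y := Subtype.ext (map_add τ (x : K →L[ℂ] K) y)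
  map_smul' c x := Subtype.ext (map_smul τ c (x : K →L[ℂ] K))
  norm_map' x := norm_apply_peripheral τ x.2

lemma shiftIsometry_surjective : Function.Surjective (shiftIsometry τ) := by
  refine peripheral_induction τ (p := fun x => ∃ y, shiftIsometry τ y = x) ?_ ?_ ?_ ?_
  · exact (shiftIsometry τ).isometry.isClosedEmbedding.isClosed_range
  · rintro _ _ ⟨x, rfl⟩ ⟨y, rfl⟩
    exact ⟨x + y, map_add _ _ _⟩
  · rintro c _ ⟨x, rfl⟩
    exact ⟨c • x, map_smul _ _ _⟩
  · intro z x hz hx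
    have hz0 : z ≠ 0 := by rintro rfl; simp at hz
    refine ⟨z⁻¹ • x, ?_⟩
    rw [map_smul]
    refine Subtype.ext ?_
    show z⁻¹ • τ x = x
    rw [hx, smul_smul, inv_mul_cancel₀ hz0, one_smul]

/-- `τ` restricts to a surjective linear isometry of `P(τ)`. -/
def shift : peripheralSpace τ ≃ₗᵢ[ℂ] peripheralSpace τ :=
  LinearIsometryEquiv.ofSurjective (shiftIsometry τ) (shiftIsometry_surjective τ)

@[simp] lemma coe_shift (x : peripheralSpace τ) : (shift τ x : K →L[ℂ] K) = τ x := rfl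

/-- `τ⁻ⁿ x`, the unique element of `P(τ)` that `τⁿ` maps to `x`. -/
def back (n : ℕ) : peripheralSpace τ ≃ₗᵢ[ℂ] peripheralSpace τ := (shift τ)⁻¹ ^ n

lemma back_zero (x : peripheralSpace τ) : back τ 0 x = x := rfl

lemma norm_back (n : ℕ) (x : peripheralSpace τ) :
    ‖(back τ n x : K →L[ℂ] K)‖ = ‖(x : K →L[ℂ] K)‖ := (back τ n).norm_map x

lemma shift_back_succ (n : ℕ) (x : peripheralSpace τ) : shift τ (back τ (n + 1) x) = back τ n x := by
  unfold back
  rw [pow_succ']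
  exact (shift τ).apply_symm_apply _

lemma back_shift (n : ℕ) (x : peripheralSpace τ) : back τ (n + 1) (shift τ x) = back τ n x := by
  unfold back
  rw [pow_succ]
  show ((shift τ)⁻¹ ^ n) ((shift τ).symm (shift τ x)) = _
  rw [LinearIsometryEquiv.symm_apply_apply]

lemma apply_back_succ (n : ℕ) (x : peripheralSpace τ) :
    τ (back τ (n + 1) x) = (back τ n x : K →L[ℂ] K) := by
  rw [← coe_shift, shift_back_succ]

lemma pow_back (n : ℕ) (x : peripheralSpace τ) :
    (τ.toCLM ^ n) (back τ n x) = (x : K →L[ℂ] K) := by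
  induction n with
  | zero => rfl
  | succ n ih =>
    rw [pow_succ]
    show (τ.toCLM ^ n) (τ (back τ (n + 1) x)) = _
    rw [apply_back_succ, ih]

lemma back_eigen {z : ℂ} (hz : z ≠ 0) {x : peripheralSpace τ} (hx : τ x = z • (x : K →L[ℂ] K))
    (n : ℕ) : back τ n x = (z ^ n)⁻¹ • x := by
  induction n with
  | zero => simp [back_zero]
  | succ n ih =>
    apply (shift τ).injective
    rw [shift_back_succ, ih, map_smul]
    refine Subtype.ext ?_
    show _ = (z ^ (n + 1))⁻¹ • τ x
    rw [hx, smul_smul, pow_succ, mul_inv, mul_assoc, inv_mul_cancel₀ hz, mul_one]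
    rfl

lemma star_mem_peripheral (x : peripheralSpace τ) : star (x : K →L[ℂ] K) ∈ peripheralSpace τ := by
  refine peripheral_induction τ (p := fun x => star (x : K →L[ℂ] K) ∈ peripheralSpace τ)
    ?_ ?_ ?_ ?_ x
  · exact (isClosed_peripheralSpace τ).preimage (continuous_star.comp continuous_subtype_val)
  · intro x y hx hy
    rw [Submodule.coe_add, star_add]; exact Submodule.add_mem _ hx hy
  · intro c x hx
    rw [Submodule.coe_smul, star_smul]; exact Submodule.smul_mem _ _ hx
  · intro z x hz hx
    refine eigenvector_mem τ (z := star z) (by simpa using hz) ?_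
    rw [mem_eigenspace, τ.map_star, hx, star_smul]

/-- The adjoint, restricted to `P(τ)`. -/
def pstar (x : peripheralSpace τ) : peripheralSpace τ := ⟨star x, star_mem_peripheral τ x⟩

@[simp] lemma coe_pstar (x : peripheralSpace τ) :
    (pstar τ x : K →L[ℂ] K) = star (x : K →L[ℂ] K) := rfl

lemma pstar_pstar (x : peripheralSpace τ) : pstar τ (pstar τ x) = x :=
  Subtype.ext (star_star _)

lemma shift_pstar (x : peripheralSpace τ) : shift τ (pstar τ x) = pstar τ (shift τ x) :=
  Subtype.ext (τ.map_star _)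

lemma back_pstar (n : ℕ) (x : peripheralSpace τ) :
    back τ n (pstar τ x) = pstar τ (back τ n x) := by
  induction n with
  | zero => rfl
  | succ n ih =>
    apply (shift τ).injective
    rw [shift_back_succ, shift_pstar, shift_back_succ, ih]

lemma pow_nonneg' (n : ℕ) {a : K →L[ℂ] K} (h : 0 ≤ a) : 0 ≤ (τ.toCLM ^ n) a := by
  induction n with
  | zero => exact h
  | succ n ih => rw [pow_succ']; exact τ.nonneg ih

lemma pow_mono (n : ℕ) {a b : K →L[ℂ] K} (h : a ≤ b) : (τ.toCLM ^ n) a ≤ (τ.toCLM ^ n) b := by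
  rw [← sub_nonneg, ← map_sub]
  exact pow_nonneg' τ n (sub_nonneg.mpr h)

lemma pow_star (n : ℕ) (a : K →L[ℂ] K) : (τ.toCLM ^ n) (star a) = star ((τ.toCLM ^ n) a) := by
  induction n with
  | zero => rfl
  | succ n ih =>
    rw [pow_succ']
    show τ ((τ.toCLM ^ n) (star a)) = star (τ ((τ.toCLM ^ n) a))
    rw [ih, τ.map_star]

lemma pow_schwarz (n : ℕ) (a : K →L[ℂ] K) :
    star ((τ.toCLM ^ n) a) * (τ.toCLM ^ n) a ≤ (τ.toCLM ^ n) (star a * a) := by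
  induction n with
  | zero => exact le_rfl
  | succ n ih =>
    rw [pow_succ']
    exact (τ.schwarz _).trans (τ.mono ih)

lemma pow_one' (n : ℕ) : (τ.toCLM ^ n) 1 = 1 := by
  induction n with
  | zero => rfl
  | succ n ih =>
    rw [pow_succ']
    show τ ((τ.toCLM ^ n) 1) = 1
    rw [ih, τ.map_one]

/-! ### The product of the peripheral Poisson boundary -/

/-- The approximants `τⁿ(τ⁻ⁿ(x) τ⁻ⁿ(y))` of the Choi--Effros product. -/
def approxProd (n : ℕ) (x y : peripheralSpace τ) : K →L[ℂ] K :=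
  (τ.toCLM ^ n) ((back τ n x : K →L[ℂ] K) * (back τ n y : K →L[ℂ] K))

lemma norm_approxProd_le (n : ℕ) (x y : peripheralSpace τ) :
    ‖approxProd τ n x y‖ ≤ ‖x‖ * ‖y‖ := by
  refine (norm_pow_apply_le τ n _).trans ((norm_mul_le _ _).trans ?_)
  rw [norm_back, norm_back]
  rfl

lemma approxProd_monotone (x : peripheralSpace τ) :
    Monotone fun n => approxProd τ n (pstar τ x) x := by
  refine monotone_nat_of_le_succ fun n => ?_
  unfold approxProd
  rw [pow_succ, back_pstar, back_pstar]
  refine pow_mono τ n ?_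
  have := τ.schwarz (back τ (n + 1) x)
  rw [apply_back_succ] at this
  exact this

lemma approxProd_le (x : peripheralSpace τ) (n : ℕ) :
    approxProd τ n (pstar τ x) x ≤ algebraMap ℝ _ (‖x‖ ^ 2) := by
  unfold approxProd
  rw [back_pstar]
  calc _ ≤ (τ.toCLM ^ n) (algebraMap ℝ _ (‖(back τ n x : K →L[ℂ] K)‖ ^ 2)) :=
        pow_mono τ n CStarAlgebra.star_mul_le_algebraMap_norm_sq
    _ = _ := by
      rw [norm_back, Algebra.algebraMap_eq_smul_one, ← Complex.coe_smul, map_smul, pow_one',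
        Algebra.algebraMap_eq_smul_one, ← Complex.coe_smul]
      rfl

/-- The vector `y + c x*` used in polarization. -/
def pol (c : ℂ) (x y : peripheralSpace τ) : peripheralSpace τ := y + c • pstar τ x

lemma mul_polar (a b : K →L[ℂ] K) : a * b = (1 / 4 : ℂ) •
    (star (b + (1 : ℂ) • star a) * (b + (1 : ℂ) • star a)
      + Complex.I • (star (b + Complex.I • star a) * (b + Complex.I • star a))
      + (-1 : ℂ) • (star (b + (-1 : ℂ) • star a) * (b + (-1 : ℂ) • star a))
      + (-Complex.I) • (star (b + (-Complex.I) • star a) * (b + (-Complex.I) • star a))) := by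
  simp only [star_add, star_smul, star_star, add_mul, mul_add, smul_mul_assoc, mul_smul_comm,
    smul_add, smul_smul]
  simp only [Complex.star_def, Complex.conj_I, map_neg, map_one]
  have hI := Complex.I_mul_I
  match_scalars <;> first | ring1 | linear_combination (1 / 2) * hI | linear_combination (-1 / 2) * hI

lemma back_pol (n : ℕ) (c : ℂ) (x y : peripheralSpace τ) :
    back τ n (pol τ c x y) = pol τ c (back τ n x) (back τ n y) := by
  unfold pol
  rw [map_add, map_smul, back_pstar]

/-- Polarization combination of a function of one variable. -/
def polSum (Q : peripheralSpace τ → K →L[ℂ] K) (x y : peripheralSpace τ) : K →L[ℂ] K :=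
  (1 / 4 : ℂ) • (Q (pol τ 1 x y) + Complex.I • Q (pol τ Complex.I x y)
    + (-1 : ℂ) • Q (pol τ (-1) x y) + (-Complex.I) • Q (pol τ (-Complex.I) x y))

lemma mul_eq_polSum (x y : peripheralSpace τ) :
    (x : K →L[ℂ] K) * (y : K →L[ℂ] K)
      = polSum τ (fun u => (pstar τ u : K →L[ℂ] K) * (u : K →L[ℂ] K)) x y :=
  mul_polar _ _

lemma approxProd_eq_polSum (n : ℕ) (x y : peripheralSpace τ) :
    approxProd τ n x y = polSum τ (fun u => approxProd τ n (pstar τ u) u) x y := by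
  unfold approxProd
  rw [mul_eq_polSum]
  unfold polSum
  simp only [map_smul, map_add, back_pstar, back_pol]

lemma tendsto_polSum {Q : ℕ → peripheralSpace τ → K →L[ℂ] K} {L : peripheralSpace τ → K →L[ℂ] K}
    {h : K} (hQ : ∀ u, Tendsto (fun n => Q n u h) atTop (𝓝 (L u h))) (x y : peripheralSpace τ) :
    Tendsto (fun n => polSum τ (Q n) x y h) atTop (𝓝 (polSum τ L x y h)) := by
  unfold polSum
  simp only [add_apply, smul_apply]
  exact ((((hQ _).add ((hQ _).const_smul _)).add ((hQ _).const_smul _)).add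
    ((hQ _).const_smul _)).const_smul _

lemma exists_sqLim (u : peripheralSpace τ) : ∃ L : K →L[ℂ] K,
    (∀ h, Tendsto (fun n => approxProd τ n (pstar τ u) u h) atTop (𝓝 (L h))) ∧
      IsLUB (Set.range fun n => approxProd τ n (pstar τ u) u) L :=
  exists_lub_of_monotone _ (approxProd_monotone τ u) _ (approxProd_le τ u)

lemma exists_prodLim (x y : peripheralSpace τ) : ∃ L : K →L[ℂ] K,
    ∀ h, Tendsto (fun n => approxProd τ n x y h) atTop (𝓝 (L h)) := by
  choose L hL using exists_sqLim τ
  refine ⟨polSum τ L x y, fun h => ?_⟩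
  simp only [approxProd_eq_polSum τ _ x y]
  exact tendsto_polSum τ (fun u => (hL u).1 h) x y

/-- The strong limit of `τⁿ(τ⁻ⁿ(x) τ⁻ⁿ(y))`, for `x, y ∈ P(τ)`. For `x ∈ E_z(τ)`, `y ∈ E_w(τ)` it is
`SOT-lim (z w)⁻ⁿ τⁿ(x y)`. -/
def prodLim (x y : peripheralSpace τ) : K →L[ℂ] K := (exists_prodLim τ x y).choose

lemma tendsto_prodLim (x y : peripheralSpace τ) (h : K) :
    Tendsto (fun n => approxProd τ n x y h) atTop (𝓝 (prodLim τ x y h)) :=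
  (exists_prodLim τ x y).choose_spec h

lemma prodLim_unique {x y : peripheralSpace τ} {L : K →L[ℂ] K}
    (hL : ∀ h, Tendsto (fun n => approxProd τ n x y h) atTop (𝓝 (L h))) : prodLim τ x y = L :=
  ContinuousLinearMap.ext fun h => tendsto_nhds_unique (tendsto_prodLim τ x y h) (hL h)

lemma isLUB_prodLim (u : peripheralSpace τ) :
    IsLUB (Set.range fun n => approxProd τ n (pstar τ u) u) (prodLim τ (pstar τ u) u) := by
  obtain ⟨L, h1, h2⟩ := exists_sqLim τ u
  rwa [prodLim_unique τ h1]

lemma prodLim_eq_polSum (x y : peripheralSpace τ) :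
    prodLim τ x y = polSum τ (fun u => prodLim τ (pstar τ u) u) x y := by
  refine prodLim_unique τ fun h => ?_
  simp only [approxProd_eq_polSum τ _ x y]
  exact tendsto_polSum τ (fun u => tendsto_prodLim τ _ _ h) x y

lemma norm_prodLim_le (x y : peripheralSpace τ) : ‖prodLim τ x y‖ ≤ ‖x‖ * ‖y‖ := by
  refine opNorm_le_bound _ (by positivity) fun h => ?_
  refine le_of_tendsto (tendsto_prodLim τ x y h).norm (Eventually.of_forall fun n => ?_)
  exact (approxProd τ n x y).le_of_opNorm_le (norm_approxProd_le τ n x y) h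

lemma apply_approxProd (n : ℕ) (x y : peripheralSpace τ) :
    τ (approxProd τ n x y) = approxProd τ (n + 1) (shift τ x) (shift τ y) := by
  unfold approxProd
  rw [back_shift, back_shift, pow_succ']
  rfl

lemma apply_prodLim_sq (u : peripheralSpace τ) :
    τ (prodLim τ (pstar τ u) u) = prodLim τ (pstar τ (shift τ u)) (shift τ u) := by
  have hmono := approxProd_monotone τ u
  have h1 := τ.normal' (Set.range fun n => approxProd τ n (pstar τ u) u) ⟨_, ⟨0, rfl⟩⟩
    (by
      rintro _ ⟨m, rfl⟩ _ ⟨n, rfl⟩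
      exact ⟨_, ⟨max m n, rfl⟩, hmono (le_max_left _ _), hmono (le_max_right _ _)⟩)
    (by
      rintro _ ⟨n, rfl⟩
      dsimp only [approxProd]
      rw [back_pstar]
      exact IsSelfAdjoint.of_nonneg (pow_nonneg' τ n (star_mul_self_nonneg _))) _
    (isLUB_prodLim τ u)
  have h2 := isLUB_prodLim τ (shift τ u)
  refine h1.unique (a := τ (prodLim τ (pstar τ u) u)) ?_
  have hmono' := approxProd_monotone τ (shift τ u)
  constructor
  · rintro _ ⟨_, ⟨n, rfl⟩, rfl⟩
    refine h2.1 ⟨n + 1, ?_⟩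
    show _ = τ _
    rw [apply_approxProd, shift_pstar]
  · intro c hc
    refine h2.2 ?_
    rintro _ ⟨n, rfl⟩
    refine (hmono' (Nat.le_succ n)).trans (hc ⟨_, ⟨n, rfl⟩, ?_⟩)
    show τ _ = _
    rw [apply_approxProd, shift_pstar]

lemma shift_pol (c : ℂ) (x y : peripheralSpace τ) :
    shift τ (pol τ c x y) = pol τ c (shift τ x) (shift τ y) := by
  unfold pol
  rw [map_add, map_smul, shift_pstar]

lemma apply_prodLim (x y : peripheralSpace τ) :
    τ (prodLim τ x y) = prodLim τ (shift τ x) (shift τ y) := by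
  rw [prodLim_eq_polSum, prodLim_eq_polSum τ (shift τ x)]
  unfold polSum
  simp only [map_smul, map_add, apply_prodLim_sq, shift_pol]

/-- The product as a bounded bilinear map. -/
def prodLimL : peripheralSpace τ →L[ℂ] peripheralSpace τ →L[ℂ] K →L[ℂ] K :=
  LinearMap.mkContinuous₂ (LinearMap.mk₂ ℂ (prodLim τ)
    (fun x₁ x₂ y => prodLim_unique τ fun h => by
      have := (tendsto_prodLim τ x₁ y h).add (tendsto_prodLim τ x₂ y h)
      simpa only [approxProd, map_add, Submodule.coe_add, add_mul, add_apply] using this)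
    (fun c x y => prodLim_unique τ fun h => by
      have := (tendsto_prodLim τ x y h).const_smul c
      simpa only [approxProd, map_smul, Submodule.coe_smul, smul_mul_assoc, smul_apply] using this)
    (fun x y₁ y₂ => prodLim_unique τ fun h => by
      have := (tendsto_prodLim τ x y₁ h).add (tendsto_prodLim τ x y₂ h)
      simpa only [approxProd, map_add, Submodule.coe_add, mul_add, add_apply] using this)
    (fun c x y => prodLim_unique τ fun h => by
      have := (tendsto_prodLim τ x y h).const_smul c
      simpa only [approxProd, map_smul, Submodule.coe_smul, mul_smul_comm, smul_apply] using this))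
    1 (fun x y => by rw [one_mul]; exact norm_prodLim_le τ x y)

lemma prodLimL_apply (x y : peripheralSpace τ) : prodLimL τ x y = prodLim τ x y := rfl

lemma prodLim_mem (x y : peripheralSpace τ) : prodLim τ x y ∈ peripheralSpace τ := by
  simp only [← prodLimL_apply]
  have hcl := isClosed_peripheralSpace τ
  refine peripheral_induction τ (p := fun x => prodLimL τ x y ∈ peripheralSpace τ) ?_ ?_ ?_ ?_ x
  · exact hcl.preimage ((prodLimL τ).flip y).continuous
  · intro x x' hx hx'
    rw [map_add, add_apply]; exact Submodule.add_mem _ hx hx'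
  · intro c x hx
    rw [map_smul, smul_apply]; exact Submodule.smul_mem _ c hx
  intro z x hz hx
  refine peripheral_induction τ (p := fun y => prodLimL τ x y ∈ peripheralSpace τ) ?_ ?_ ?_ ?_ y
  · exact hcl.preimage (prodLimL τ x).continuous
  · intro y y' hy hy'
    rw [map_add]; exact Submodule.add_mem _ hy hy'
  · intro c y hy
    rw [map_smul]; exact Submodule.smul_mem _ c hy
  intro w y hw hy
  refine eigenvector_mem τ (z := z * w) (by rw [norm_mul, hz, hw, one_mul]) ?_
  have hx' : shift τ x = z • x := Subtype.ext hx
  have hy' : shift τ y = w • y := Subtype.ext hy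
  rw [mem_eigenspace, prodLimL_apply, apply_prodLim, hx', hy', ← prodLimL_apply, map_smul, map_smul,
    smul_apply, smul_smul, prodLimL_apply, mul_comm]

/-- The modified Choi--Effros product `x ∘ y` on `P(τ)`. -/
def choiEffros (x y : peripheralSpace τ) : peripheralSpace τ := ⟨prodLim τ x y, prodLim_mem τ x y⟩

end Peripheral

section Algebra

set_option linter.unusedSectionVars false

variable {K : Type u} [NormedAddCommGroup K] [InnerProductSpace ℂ K] [CompleteSpace K]
variable (τ : NormalUCPMap K)

lemma coe_choiEffros (x y : peripheralSpace τ) :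
    (choiEffros τ x y : K →L[ℂ] K) = prodLim τ x y := rfl

lemma shift_choiEffros (x y : peripheralSpace τ) :
    shift τ (choiEffros τ x y) = choiEffros τ (shift τ x) (shift τ y) :=
  Subtype.ext (apply_prodLim τ x y)

lemma back_choiEffros (n : ℕ) (x y : peripheralSpace τ) :
    back τ n (choiEffros τ x y) = choiEffros τ (back τ n x) (back τ n y) := by
  induction n with
  | zero => rfl
  | succ n ih =>
    apply (shift τ).injective
    rw [shift_back_succ, ih, shift_choiEffros, shift_back_succ, shift_back_succ]

/-- The defect `x ∘ y - x y` at time `-n`. -/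
def defect (n : ℕ) (x y : peripheralSpace τ) : K →L[ℂ] K :=
  prodLim τ (back τ n x) (back τ n y) - (back τ n x : K →L[ℂ] K) * (back τ n y : K →L[ℂ] K)

lemma pow_prodLim_back (n : ℕ) (x y : peripheralSpace τ) :
    (τ.toCLM ^ n) (prodLim τ (back τ n x) (back τ n y)) = prodLim τ x y := by
  rw [← coe_choiEffros, ← back_choiEffros, pow_back, coe_choiEffros]

lemma pow_defect (n : ℕ) (x y : peripheralSpace τ) :
    (τ.toCLM ^ n) (defect τ n x y) = prodLim τ x y - approxProd τ n x y := by
  unfold defect approxProd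
  rw [map_sub, pow_prodLim_back]

lemma defect_eq_polSum (n : ℕ) (x y : peripheralSpace τ) :
    defect τ n x y = polSum τ (fun u => defect τ n (pstar τ u) u) x y := by
  unfold defect
  rw [prodLim_eq_polSum, mul_eq_polSum]
  unfold polSum
  simp only [back_pstar, back_pol]
  module

lemma mul_le_prodLim (u : peripheralSpace τ) :
    star (u : K →L[ℂ] K) * u ≤ prodLim τ (pstar τ u) u :=
  (isLUB_prodLim τ u).1 ⟨0, rfl⟩

lemma defect_nonneg (n : ℕ) (u : peripheralSpace τ) : 0 ≤ defect τ n (pstar τ u) u := by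
  unfold defect
  rw [back_pstar, sub_nonneg]
  exact mul_le_prodLim τ _

lemma norm_defect_le (n : ℕ) (x y : peripheralSpace τ) :
    ‖defect τ n x y‖ ≤ 2 * (‖x‖ * ‖y‖) := by
  have h1 := norm_prodLim_le τ (back τ n x) (back τ n y)
  have h2 := norm_mul_le (back τ n x : K →L[ℂ] K) (back τ n y : K →L[ℂ] K)
  rw [norm_back, norm_back] at h2
  rw [LinearIsometryEquiv.norm_map, LinearIsometryEquiv.norm_map] at h1
  calc _ ≤ _ := norm_sub_le _ _
    _ ≤ ‖x‖ * ‖y‖ + ‖x‖ * ‖y‖ := add_le_add h1 h2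
    _ = _ := by ring

lemma re_inner_mono {a b : K →L[ℂ] K} (h : a ≤ b) (v : K) :
    RCLike.re ⟪a v, v⟫_ℂ ≤ RCLike.re ⟪b v, v⟫_ℂ := by
  have := ((le_def _ _).mp h).re_inner_nonneg_left v
  rw [sub_apply, inner_sub_left, map_sub] at this
  linarith

lemma norm_pow_mul_apply_sq_le (n : ℕ) (a b : K →L[ℂ] K) (hb : 0 ≤ b) (v : K) :
    ‖(τ.toCLM ^ n) (a * b) v‖ ^ 2
      ≤ ‖a‖ ^ 2 * ‖b‖ * RCLike.re ⟪(τ.toCLM ^ n) b v, v⟫_ℂ := by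
  have h1 : ‖(τ.toCLM ^ n) (a * b) v‖ ^ 2 = RCLike.re
      ⟪(star ((τ.toCLM ^ n) (a * b)) * (τ.toCLM ^ n) (a * b)) v, v⟫_ℂ := by
    have : ⟪(star ((τ.toCLM ^ n) (a * b)) * (τ.toCLM ^ n) (a * b)) v, v⟫_ℂ
        = ⟪(τ.toCLM ^ n) (a * b) v, (τ.toCLM ^ n) (a * b) v⟫_ℂ :=
      adjoint_inner_left ((τ.toCLM ^ n) (a * b)) v ((τ.toCLM ^ n) (a * b) v)
    rw [this, inner_self_eq_norm_sq]
  have hbs : star b = b := (IsSelfAdjoint.of_nonneg hb).star_eq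
  have h2 : star (a * b) * (a * b) ≤ (‖a‖ ^ 2 * ‖b‖ : ℝ) • b := by
    have e1 : star (a * b) * (a * b) = star b * (star a * a) * b := by
      rw [star_mul]; simp only [mul_assoc]
    have e2 : star b * (star a * a) * b ≤ star b * (algebraMap ℝ _ (‖a‖ ^ 2)) * b :=
      star_left_conjugate_le_conjugate CStarAlgebra.star_mul_le_algebraMap_norm_sq b
    have e3 : star b * (algebraMap ℝ (K →L[ℂ] K) (‖a‖ ^ 2)) * b = (‖a‖ ^ 2 : ℝ) • (b * b) := by
      rw [hbs, Algebra.algebraMap_eq_smul_one, mul_smul_comm, mul_one, smul_mul_assoc]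
    have e4 : b * b ≤ (‖b‖ : ℝ) • b := by
      obtain ⟨c, hc⟩ := CStarAlgebra.nonneg_iff_eq_star_mul_self.mp hb
      have hn : ‖b‖ = ‖c‖ ^ 2 := by rw [hc, CStarRing.norm_star_mul_self, sq]
      have hn' : ‖b‖ = ‖star c‖ ^ 2 := by rw [hn, norm_star]
      have e5 : star c * (star (star c) * star c) * c
          ≤ star c * (algebraMap ℝ _ (‖star c‖ ^ 2)) * c :=
        star_left_conjugate_le_conjugate CStarAlgebra.star_mul_le_algebraMap_norm_sq c
      rw [← hn', Algebra.algebraMap_eq_smul_one, mul_smul_comm, mul_one, smul_mul_assoc, ← hc,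
        star_star] at e5
      refine le_trans (le_of_eq ?_) e5
      rw [hc]; simp only [mul_assoc]
    rw [e1]
    refine e2.trans (e3.le.trans ?_)
    rw [mul_smul]
    exact smul_le_smul_of_nonneg_left e4 (by positivity)
  have h3 := re_inner_mono ((pow_schwarz τ n (a * b)).trans (pow_mono τ n h2)) v
  rw [h1]
  refine h3.trans (le_of_eq ?_)
  rw [← Complex.coe_smul, map_smul, smul_apply, inner_smul_left, Complex.conj_ofReal]
  exact RCLike.re_ofReal_mul (K := ℂ) _ _

lemma tendsto_pow_mul_defect_sq (x u : peripheralSpace τ) (v : K) :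
    Tendsto (fun n => (τ.toCLM ^ n) ((back τ n x : K →L[ℂ] K) * defect τ n (pstar τ u) u) v)
      atTop (𝓝 0) := by
  have h1 : Tendsto (fun n => ‖x‖ ^ 2 * (2 * (‖pstar τ u‖ * ‖u‖)) *
      RCLike.re ⟪(prodLim τ (pstar τ u) u - approxProd τ n (pstar τ u) u) v, v⟫_ℂ) atTop (𝓝 0) := by
    have e1 : Tendsto (fun n => (prodLim τ (pstar τ u) u - approxProd τ n (pstar τ u) u) v)
        atTop (𝓝 0) := by
      have := (tendsto_const_nhds (x := prodLim τ (pstar τ u) u v)).sub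
        (tendsto_prodLim τ (pstar τ u) u v)
      rw [sub_self] at this
      exact this
    have e2 : Tendsto (fun n => ⟪(prodLim τ (pstar τ u) u - approxProd τ n (pstar τ u) u) v, v⟫_ℂ)
        atTop (𝓝 ⟪(0 : K), v⟫_ℂ) := e1.inner tendsto_const_nhds
    have e3 := (RCLike.continuous_re.tendsto _).comp e2
    have e4 := e3.const_mul (‖x‖ ^ 2 * (2 * (‖pstar τ u‖ * ‖u‖)))
    rw [inner_zero_left, map_zero, mul_zero] at e4
    exact e4
  have h2 : Tendsto (fun n => ‖(τ.toCLM ^ n)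
      ((back τ n x : K →L[ℂ] K) * defect τ n (pstar τ u) u) v‖ ^ 2) atTop (𝓝 0) := by
    refine squeeze_zero (fun n => by positivity) (fun n => ?_) h1
    have := norm_pow_mul_apply_sq_le τ n (back τ n x) _ (defect_nonneg τ n u) v
    rw [pow_defect] at this
    refine this.trans (mul_le_mul_of_nonneg_right ?_ ?_)
    · rw [norm_back]
      exact mul_le_mul_of_nonneg_left (norm_defect_le τ n _ _) (by positivity)
    · have h0 : approxProd τ n (pstar τ u) u ≤ prodLim τ (pstar τ u) u :=
        (isLUB_prodLim τ u).1 ⟨n, rfl⟩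
      exact ((le_def _ _).mp h0).re_inner_nonneg_left v
  rw [tendsto_zero_iff_norm_tendsto_zero]
  have h3 := (Real.continuous_sqrt.tendsto 0).comp h2
  simpa [Function.comp_def, Real.sqrt_sq (norm_nonneg _)] using h3

lemma tendsto_pow_mul_defect (x y z : peripheralSpace τ) (v : K) :
    Tendsto (fun n => (τ.toCLM ^ n) ((back τ n x : K →L[ℂ] K) * defect τ n y z) v)
      atTop (𝓝 0) := by
  have h := tendsto_polSum τ (L := fun _ => 0) (h := v)
    (Q := fun n u => (τ.toCLM ^ n) ((back τ n x : K →L[ℂ] K) * defect τ n (pstar τ u) u))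
    (fun u => tendsto_pow_mul_defect_sq τ x u v) y z
  have e : polSum τ (fun _ => (0 : K →L[ℂ] K)) y z v = 0 := by simp [polSum]
  rw [e] at h
  refine h.congr fun n => ?_
  rw [defect_eq_polSum]
  unfold polSum
  simp only [map_smul, map_add, mul_add, mul_smul_comm]

/-- The triple approximants `τⁿ(τ⁻ⁿ(x) τ⁻ⁿ(y) τ⁻ⁿ(z))`. -/
def approxTriple (n : ℕ) (x y z : peripheralSpace τ) : K →L[ℂ] K :=
  (τ.toCLM ^ n) ((back τ n x : K →L[ℂ] K) * (back τ n y : K →L[ℂ] K) * (back τ n z : K →L[ℂ] K))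

lemma tendsto_approxTriple (x y z : peripheralSpace τ) (v : K) :
    Tendsto (fun n => approxTriple τ n x y z v) atTop
      (𝓝 (prodLim τ x (choiEffros τ y z) v)) := by
  have h := (tendsto_prodLim τ x (choiEffros τ y z) v).sub (tendsto_pow_mul_defect τ x y z v)
  rw [sub_zero] at h
  refine h.congr fun n => ?_
  unfold approxProd approxTriple defect
  rw [back_choiEffros, coe_choiEffros, mul_sub, map_sub, sub_apply, sub_sub_cancel, mul_assoc]

lemma star_approxProd (n : ℕ) (x y : peripheralSpace τ) :
    star (approxProd τ n x y) = approxProd τ n (pstar τ y) (pstar τ x) := by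
  unfold approxProd
  rw [← pow_star, star_mul, back_pstar, back_pstar]
  rfl

lemma inner_star_apply (a : K →L[ℂ] K) (v w : K) : ⟪star a v, w⟫_ℂ = ⟪v, a w⟫_ℂ :=
  adjoint_inner_left a w v

lemma star_prodLim (x y : peripheralSpace τ) :
    star (prodLim τ x y) = prodLim τ (pstar τ y) (pstar τ x) := by
  refine ContinuousLinearMap.ext fun v => ext_inner_right ℂ fun w => ?_
  have h1 : Tendsto (fun n => ⟪star (approxProd τ n x y) v, w⟫_ℂ) atTop
      (𝓝 ⟪star (prodLim τ x y) v, w⟫_ℂ) := by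
    simp only [inner_star_apply]
    exact tendsto_const_nhds.inner (tendsto_prodLim τ x y w)
  simp only [star_approxProd] at h1
  exact tendsto_nhds_unique h1 ((tendsto_prodLim τ _ _ v).inner tendsto_const_nhds)

lemma star_approxTriple (n : ℕ) (x y z : peripheralSpace τ) :
    star (approxTriple τ n x y z) = approxTriple τ n (pstar τ z) (pstar τ y) (pstar τ x) := by
  unfold approxTriple
  rw [← pow_star, star_mul, star_mul, back_pstar, back_pstar, back_pstar, mul_assoc]
  rfl

lemma pstar_choiEffros (x y : peripheralSpace τ) :
    pstar τ (choiEffros τ x y) = choiEffros τ (pstar τ y) (pstar τ x) :=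
  Subtype.ext (star_prodLim τ x y)

lemma choiEffros_assoc (x y z : peripheralSpace τ) :
    choiEffros τ (choiEffros τ x y) z = choiEffros τ x (choiEffros τ y z) := by
  refine Subtype.ext ?_
  have e : (choiEffros τ (choiEffros τ x y) z : K →L[ℂ] K)
      = star (prodLim τ (pstar τ z) (choiEffros τ (pstar τ y) (pstar τ x))) := by
    rw [star_prodLim, pstar_choiEffros, pstar_pstar, pstar_pstar, pstar_pstar]
    rfl
  rw [e]
  refine ContinuousLinearMap.ext fun v => ext_inner_right ℂ fun w => ?_
  have h1 := (tendsto_const_nhds (x := v)).inner (𝕜 := ℂ)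
    (tendsto_approxTriple τ (pstar τ z) (pstar τ y) (pstar τ x) w)
  simp only [← inner_star_apply, star_approxTriple, pstar_pstar] at h1
  exact tendsto_nhds_unique h1 ((tendsto_approxTriple τ x y z v).inner tendsto_const_nhds)

lemma one_mem_peripheral : (1 : K →L[ℂ] K) ∈ peripheralSpace τ :=
  eigenvector_mem τ (z := 1) (by simp) (by rw [mem_eigenspace, τ.map_one, one_smul])

/-- The unit of `P(τ)`. -/
def pone : peripheralSpace τ := ⟨1, one_mem_peripheral τ⟩

lemma back_pone (n : ℕ) : back τ n (pone τ) = pone τ := by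
  have h : τ (pone τ) = (1 : ℂ) • (pone τ : K →L[ℂ] K) := by
    rw [one_smul]; exact τ.map_one
  rw [back_eigen τ one_ne_zero h, one_pow, inv_one, one_smul]

lemma pone_choiEffros (x : peripheralSpace τ) : choiEffros τ (pone τ) x = x := by
  refine Subtype.ext (prodLim_unique τ fun h => ?_)
  refine tendsto_const_nhds.congr fun n => ?_
  unfold approxProd
  rw [back_pone]
  show _ = (τ.toCLM ^ n) (1 * (back τ n x : K →L[ℂ] K)) h
  rw [one_mul, pow_back]

lemma choiEffros_pone (x : peripheralSpace τ) : choiEffros τ x (pone τ) = x := by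
  refine Subtype.ext (prodLim_unique τ fun h => ?_)
  refine tendsto_const_nhds.congr fun n => ?_
  unfold approxProd
  rw [back_pone]
  show _ = (τ.toCLM ^ n) ((back τ n x : K →L[ℂ] K) * 1) h
  rw [mul_one, pow_back]

lemma norm_sq_le_choiEffros (x : peripheralSpace τ) :
    ‖x‖ * ‖x‖ ≤ ‖choiEffros τ (pstar τ x) x‖ := by
  have h := CStarAlgebra.norm_le_norm_of_nonneg_of_le (star_mul_self_nonneg (x : K →L[ℂ] K))
    (mul_le_prodLim τ x)
  rw [CStarRing.norm_star_mul_self] at h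
  exact h

end Algebra

section Boundary

variable {K : Type u} [NormedAddCommGroup K] [InnerProductSpace ℂ K] [CompleteSpace K]

/-- The peripheral Poisson boundary of a normal ucp map `τ`: the operator space `P(τ)` with the
modified Choi--Effros product. -/
def PeripheralPoissonBoundary (τ : NormalUCPMap K) : Type u := peripheralSpace τ

namespace PeripheralPoissonBoundary

variable {τ : NormalUCPMap K}

instance : NormedAddCommGroup (PeripheralPoissonBoundary τ) :=
  inferInstanceAs (NormedAddCommGroup (peripheralSpace τ))

instance : NormedSpace ℂ (PeripheralPoissonBoundary τ) :=
  inferInstanceAs (NormedSpace ℂ (peripheralSpace τ))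

instance : CompleteSpace (PeripheralPoissonBoundary τ) :=
  inferInstanceAs (CompleteSpace (peripheralSpace τ))

/-- The operator underlying an element of the peripheral Poisson boundary. -/
def toOp (x : PeripheralPoissonBoundary τ) : K →L[ℂ] K := (show peripheralSpace τ from x).1

instance : Ring (PeripheralPoissonBoundary τ) :=
  { (inferInstance : AddCommGroup (PeripheralPoissonBoundary τ)) with
    mul := choiEffros τ
    one := pone τ
    mul_assoc := choiEffros_assoc τ
    one_mul := pone_choiEffros τ
    mul_one := choiEffros_pone τ
    left_distrib := fun x y z => Subtype.ext (map_add (prodLimL τ x) y z)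
    right_distrib := fun x y z => Subtype.ext (map_add₂ (prodLimL τ) x y z)
    zero_mul := fun x => Subtype.ext (map_zero₂ (prodLimL τ) x)
    mul_zero := fun x => Subtype.ext (map_zero (prodLimL τ x)) }

instance : NormedRing (PeripheralPoissonBoundary τ) :=
  { (inferInstance : NormedAddCommGroup (PeripheralPoissonBoundary τ)),
    (inferInstance : Ring (PeripheralPoissonBoundary τ)) with
    norm_mul_le := norm_prodLim_le τ }

instance : Algebra ℂ (PeripheralPoissonBoundary τ) :=
  Algebra.ofModule (fun c x y => Subtype.ext (map_smul₂ (prodLimL τ) c x y))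
    (fun c x y => Subtype.ext (map_smul (prodLimL τ x) c y))

instance : NormedAlgebra ℂ (PeripheralPoissonBoundary τ) where
  norm_smul_le c x := norm_smul_le (β := peripheralSpace τ) c x

instance : StarRing (PeripheralPoissonBoundary τ) where
  star := pstar τ
  star_involutive := pstar_pstar τ
  star_mul := pstar_choiEffros τ
  star_add x y := Subtype.ext (star_add x.1 y.1)

instance : StarModule ℂ (PeripheralPoissonBoundary τ) where
  star_smul c x := Subtype.ext (star_smul c x.1)

/-- `P(τ)` with the modified Choi--Effros product is a unital C⋆-algebra. -/
instance : CStarAlgebra (PeripheralPoissonBoundary τ) where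
  norm_mul_self_le := norm_sq_le_choiEffros τ

end PeripheralPoissonBoundary

end Boundary

section Comparison

variable {K : Type u} [NormedAddCommGroup K] [InnerProductSpace ℂ K] [CompleteSpace K]
variable (τ : NormalUCPMap K)

lemma tendsto_approx_of_eigen {z w : ℂ} (hz : z ≠ 0) (hw : w ≠ 0) (x y : peripheralSpace τ)
    (hx : τ x = z • (x : K →L[ℂ] K)) (hy : τ y = w • (y : K →L[ℂ] K)) (h : K) :
    Tendsto (fun n => (((z * w) ^ n)⁻¹ • (τ.toCLM ^ n) ((x : K →L[ℂ] K) * (y : K →L[ℂ] K))) h) atTop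
      (𝓝 (prodLim τ x y h)) := by
  refine (tendsto_prodLim τ x y h).congr fun n => ?_
  unfold approxProd
  rw [back_eigen τ hz hx n, back_eigen τ hw hy n, Submodule.coe_smul, Submodule.coe_smul,
    smul_mul_smul_comm, map_smul, mul_pow, mul_inv]

/-- On eigenvectors the product is `x ∘ y = SOT-lim (z w)⁻ⁿ τⁿ(x y)`. -/
theorem tendsto_mul_of_eigen {z w : ℂ} (hz : ‖z‖ = 1) (hw : ‖w‖ = 1)
    (x y : PeripheralPoissonBoundary τ) (hx : τ x.toOp = z • x.toOp) (hy : τ y.toOp = w • y.toOp)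
    (h : K) : Tendsto (fun n => (((z * w) ^ n)⁻¹ • (τ.toCLM ^ n) (x.toOp * y.toOp)) h) atTop
      (𝓝 ((x * y).toOp h)) :=
  tendsto_approx_of_eigen τ (by rintro rfl; simp at hz) (by rintro rfl; simp at hw) x y hx hy h

variable {K' : Type v} [NormedAddCommGroup K'] [InnerProductSpace ℂ K'] [CompleteSpace K']
  (V : K →ₗᵢ[ℂ] K') (B : StarSubalgebra ℂ (K' →L[ℂ] K')) (θ : B →⋆ₐ[ℂ] B)

/-- The compression `z ↦ V^* z V`. -/
def compression : (K' →L[ℂ] K') →ₗ[ℂ] (K →L[ℂ] K) where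
  toFun z := adjoint V.toContinuousLinearMap ∘L z ∘L V.toContinuousLinearMap
  map_add' z w := by rw [add_comp, comp_add]
  map_smul' c z := by rw [smul_comp, comp_smul]; rfl

lemma compression_apply (z : K' →L[ℂ] K') (h : K) :
    compression V z h = adjoint V.toContinuousLinearMap (z (V h)) := rfl

lemma adjoint_V_apply (h : K) : adjoint V.toContinuousLinearMap (V h) = h := by
  have := (norm_map_iff_adjoint_comp_self V.toContinuousLinearMap).mp V.norm_map
  exact congrArg (fun a : K →L[ℂ] K => a h) this

/-- Let `(K', B, θ)` be a minimal dilation of `τ`: `V` embeds `K` isometrically in `K'`, the copy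
`V x V^*` of `B(K)` lies in the *-algebra `B`, `θ` is a unital *-endomorphism of `B`
that compresses to `τ`, and `K'` is the smallest closed subspace that contains `V K` and is
invariant under all `θⁿ(V x V^*)`. Then the compression `T(b) = V^* b V` maps eigenvectors of `θ` to
eigenvectors of `τ` and `T(b c) = T(b) ∘ T(c)`. By linearity and continuity the product above is
therefore the one transported from the dilation, `x ∘ y = T(T⁻¹(x) T⁻¹(y))`. -/
theorem compression_mul_of_eigen (j : (K →L[ℂ] K) → B)
    (hj : ∀ x, (j x : K' →L[ℂ] K') =
      V.toContinuousLinearMap ∘L x ∘L adjoint V.toContinuousLinearMap)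
    (hdil : ∀ x, compression V (θ (j x)) = τ x)
    (hmin : ∀ F : Submodule ℂ K', IsClosed (F : Set K') → (∀ h, V h ∈ F) →
      (∀ n x, ∀ k ∈ F, (θ^[n] (j x) : K' →L[ℂ] K') k ∈ F) → F = ⊤)
    {z w : ℂ} (hz : ‖z‖ = 1) (hw : ‖w‖ = 1) (b c : B) (hb : θ b = z • b) (hc : θ c = w • c) :
    ∃ x y : PeripheralPoissonBoundary τ,
      x.toOp = compression V b ∧ y.toOp = compression V c ∧
      τ x.toOp = z • x.toOp ∧ τ y.toOp = w • y.toOp ∧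
      (x * y).toOp = compression V ((b * c : B) : K' →L[ℂ] K') := by
  have hjV : ∀ x h, (j x : K' →L[ℂ] K') (V h) = V (x h) := fun x h => by
    rw [hj]
    show V (x (adjoint V.toContinuousLinearMap (V h))) = _
    rw [adjoint_V_apply]
  have hjmul : ∀ x y, j (x * y) = j x * j y := fun x y => by
    refine Subtype.ext (ContinuousLinearMap.ext fun k => ?_)
    show (j (x * y) : K' →L[ℂ] K') k = (j x : K' →L[ℂ] K') ((j y : K' →L[ℂ] K') k)
    rw [hj y]
    show _ = (j x : K' →L[ℂ] K') (V _)
    rw [hjV, hj]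
    rfl
  have hjstar : ∀ x, star (j x) = j (star x) := fun x => by
    refine Subtype.ext ?_
    show star (j x : K' →L[ℂ] K') = _
    rw [hj, hj, star_eq_adjoint, adjoint_comp, adjoint_comp, adjoint_adjoint]
    rfl
  set p : B := j 1 with hp
  have hpp : p * p = p := by rw [hp, ← hjmul, mul_one]
  have hps : star p = p := by rw [hp, hjstar, star_one]
  -- compressions of elements of `B`
  have hcomp : ∀ d : B, j (compression V d) = p * d * p := fun d => by
    refine Subtype.ext (ContinuousLinearMap.ext fun k => ?_)
    show _ = (p : K' →L[ℂ] K') ((d : K' →L[ℂ] K') ((p : K' →L[ℂ] K') k))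
    rw [hp, hj, hj]
    rfl
  have hθ : ∀ (n : ℕ) (a b : B), θ^[n] (a * b) = θ^[n] a * θ^[n] b := fun n a b => by
    induction n generalizing a b with
    | zero => rfl
    | succ n ih => rw [Function.iterate_succ_apply, map_mul, ih]; rfl
  have hθs : ∀ (n : ℕ) (a : B), θ^[n] (star a) = star (θ^[n] a) := fun n a => by
    induction n generalizing a with
    | zero => rfl
    | succ n ih => rw [Function.iterate_succ_apply, map_star, ih]; rfl
  -- the projections `θⁿ(p)`
  have hnormp : ∀ n k, ‖(θ^[n] p : K' →L[ℂ] K') k‖ ^ 2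
      = RCLike.re ⟪(θ^[n] p : K' →L[ℂ] K') k, k⟫_ℂ := fun n k => by
    have e : star (θ^[n] p) * θ^[n] p = θ^[n] p := by rw [← hθs, hps, ← hθ, hpp]
    have e' : ((star (θ^[n] p) * θ^[n] p : B) : K' →L[ℂ] K') k = (θ^[n] p : K' →L[ℂ] K') k := by
      rw [e]
    have e2 : ⟪(θ^[n] p : K' →L[ℂ] K') k, k⟫_ℂ
        = ⟪(θ^[n] p : K' →L[ℂ] K') k, (θ^[n] p : K' →L[ℂ] K') k⟫_ℂ := by
      conv_lhs => rw [← e']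
      exact adjoint_inner_left (θ^[n] p : K' →L[ℂ] K') k ((θ^[n] p : K' →L[ℂ] K') k)
    rw [e2, inner_self_eq_norm_sq]
  have hple : ∀ n k, ‖(θ^[n] p : K' →L[ℂ] K') k‖ ≤ ‖k‖ := fun n k => by
    have h1 := hnormp n k
    have h2 := re_inner_le_norm (𝕜 := ℂ) ((θ^[n] p : K' →L[ℂ] K') k) k
    by_contra! hcon
    nlinarith [norm_nonneg k, norm_nonneg ((θ^[n] p : K' →L[ℂ] K') k)]
  have hθpV : ∀ h, (θ p : K' →L[ℂ] K') (V h) = V h := fun h => by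
    have h1 := hnormp 1 (V h)
    have h2 : ⟪(θ p : K' →L[ℂ] K') (V h), V h⟫_ℂ = ⟪h, h⟫_ℂ := by
      have h3 : compression V (θ p) h = h := by rw [hdil, τ.map_one]; rfl
      rw [compression_apply] at h3
      have h4 : ⟪adjoint V.toContinuousLinearMap ((θ p : K' →L[ℂ] K') (V h)), h⟫_ℂ
          = ⟪(θ p : K' →L[ℂ] K') (V h), V h⟫_ℂ := adjoint_inner_left _ _ _
      rw [← h4, h3]
    have h5 : ‖(θ p : K' →L[ℂ] K') (V h) - V h‖ ^ 2 = 0 := by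
      rw [norm_sub_sq (𝕜 := ℂ)]
      change ‖(θ p : K' →L[ℂ] K') (V h)‖ ^ 2 = _ at h1
      rw [h1]
      change RCLike.re ⟪(θ p : K' →L[ℂ] K') (V h), V h⟫_ℂ - _ + _ = _
      rw [h2, inner_self_eq_norm_sq, V.norm_map]
      ring
    exact sub_eq_zero.mp (norm_eq_zero.mp (pow_eq_zero_iff two_ne_zero |>.mp h5))
  have hθpp : θ p * p = p := by
    refine Subtype.ext (ContinuousLinearMap.ext fun k => ?_)
    show (θ p : K' →L[ℂ] K') ((p : K' →L[ℂ] K') k) = (p : K' →L[ℂ] K') k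
    rw [hp, hj]
    exact hθpV _
  have hmn : ∀ n m, θ^[n + m] p * θ^[n] p = θ^[n] p := fun n m => by
    induction m with
    | zero => rw [add_zero, ← hθ, hpp]
    | succ m ih =>
      have e : θ^[n + (m + 1)] p * θ^[n + m] p = θ^[n + m] p := by
        rw [← add_assoc, Function.iterate_succ_apply, ← hθ, hθpp]
      calc _ = θ^[n + (m + 1)] p * (θ^[n + m] p * θ^[n] p) := by rw [ih]
        _ = θ^[n] p := by rw [← mul_assoc, e, ih]
  have hpV : ∀ n h, (θ^[n] p : K' →L[ℂ] K') (V h) = V h := fun n h => by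
    have h0 : (p : K' →L[ℂ] K') (V h) = V h := hjV 1 h
    have h1 := congrArg (fun a : B => (a : K' →L[ℂ] K') (V h)) (hmn 0 n)
    rw [zero_add] at h1
    change (θ^[n] p : K' →L[ℂ] K') ((p : K' →L[ℂ] K') (V h)) = (p : K' →L[ℂ] K') (V h) at h1
    rwa [h0] at h1
  have hlim : ∀ k, Tendsto (fun n => (θ^[n] p : K' →L[ℂ] K') k) atTop (𝓝 k) := by
    let F : Submodule ℂ K' :=
      { carrier := {k | Tendsto (fun n => (θ^[n] p : K' →L[ℂ] K') k) atTop (𝓝 k)}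
        add_mem' := fun {a b} ha hb => by
          rw [Set.mem_ofPred_eq] at *
          simpa only [map_add] using ha.add hb
        zero_mem' := by
          rw [Set.mem_ofPred_eq]
          simp only [map_zero]
          exact tendsto_const_nhds
        smul_mem' := fun r a ha => by
          rw [Set.mem_ofPred_eq] at *
          simpa only [map_smul] using ha.const_smul r }
    have hF : F = ⊤ := by
      refine hmin F ?_ (fun h => ?_) (fun n x k _ => ?_)
      · refine isClosed_of_closure_subset fun k hk => ?_
        show Tendsto (fun n => (θ^[n] p : K' →L[ℂ] K') k) atTop (𝓝 k)
        rw [Metric.tendsto_atTop]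
        intro ε hε
        obtain ⟨k', hk', hd⟩ := Metric.mem_closure_iff.mp hk (ε / 3) (by positivity)
        obtain ⟨N, hN⟩ := Metric.tendsto_atTop.mp
          (show Tendsto (fun n => (θ^[n] p : K' →L[ℂ] K') k') atTop (𝓝 k') from hk') (ε / 3)
          (by positivity)
        refine ⟨N, fun n hn => ?_⟩
        have h1 := hN n hn
        have h2 : dist ((θ^[n] p : K' →L[ℂ] K') k) ((θ^[n] p : K' →L[ℂ] K') k') ≤ dist k k' := by
          rw [dist_eq_norm, dist_eq_norm, ← map_sub]; exact hple n _
        calc _ ≤ dist ((θ^[n] p : K' →L[ℂ] K') k) ((θ^[n] p : K' →L[ℂ] K') k')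
              + dist ((θ^[n] p : K' →L[ℂ] K') k') k' + dist k' k := dist_triangle4 _ _ _ _
          _ < ε := by rw [dist_comm k' k]; linarith
      · show Tendsto _ _ _
        simp only [hpV]
        exact tendsto_const_nhds
      · show Tendsto _ _ _
        refine tendsto_const_nhds.congr' ?_
        filter_upwards [Ici_mem_atTop n] with m hm
        obtain ⟨l, rfl⟩ := Nat.exists_eq_add_of_le hm
        have e : θ^[n + l] p * θ^[n] (j x) = θ^[n] (j x) := by
          have e1 : j x = p * j x := by rw [hp, ← hjmul, one_mul]
          conv_lhs => rw [e1, hθ, ← mul_assoc, hmn, ← hθ, ← e1]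
        exact (congrArg (fun a : B => (a : K' →L[ℂ] K') k) e).symm
    intro k
    have : k ∈ F := hF ▸ Submodule.mem_top
    exact this
  -- `T θ = τ T`
  have hTθ : ∀ d : B, compression V (θ d) = τ (compression V d) := fun d => by
    rw [← hdil, hcomp, map_mul, map_mul]
    refine ContinuousLinearMap.ext fun h => ext_inner_right ℂ fun v => ?_
    have h1 : ∀ (e : K' →L[ℂ] K'), ⟪compression V e h, v⟫_ℂ = ⟪e (V h), V v⟫_ℂ := fun e =>
      adjoint_inner_left V.toContinuousLinearMap v (e (V h))
    rw [h1, h1]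
    have hs : star (θ p : K' →L[ℂ] K') = θ p := congrArg Subtype.val (((hθs 1 p).symm.trans
      (congrArg θ hps)) : star (θ p) = θ p)
    have h2 : ((θ p * θ d * θ p : B) : K' →L[ℂ] K') (V h)
        = star (θ p : K' →L[ℂ] K') ((θ d : K' →L[ℂ] K') (V h)) := by
      rw [hs]
      show (θ p : K' →L[ℂ] K') ((θ d : K' →L[ℂ] K') ((θ p : K' →L[ℂ] K') (V h))) = _
      rw [hθpV]
    rw [h2, star_eq_adjoint, adjoint_inner_left, hθpV]
  have hTn : ∀ (n : ℕ) (d : B),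
      compression V (θ^[n] d) = (τ.toCLM ^ n) (compression V d) := fun n d => by
    induction n generalizing d with
    | zero => rfl
    | succ n ih =>
      rw [Function.iterate_succ_apply, ih, hTθ, pow_succ]
      rfl
  have hx : τ (compression V b) = z • compression V b := by
    rw [← hTθ, hb]; exact map_smul (compression V) z _
  have hy : τ (compression V c) = w • compression V c := by
    rw [← hTθ, hc]; exact map_smul (compression V) w _
  let x : PeripheralPoissonBoundary τ := (⟨_, eigenvector_mem τ hz hx⟩ : peripheralSpace τ)
  let y : PeripheralPoissonBoundary τ := (⟨_, eigenvector_mem τ hw hy⟩ : peripheralSpace τ)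
  refine ⟨x, y, rfl, rfl, hx, hy, ?_⟩
  have hiter : ∀ (s : ℂ) (d : B), θ d = s • d → ∀ n, θ^[n] d = s ^ n • d := fun s d hd n => by
    induction n with
    | zero => rw [pow_zero, one_smul]; rfl
    | succ n ih => rw [Function.iterate_succ_apply', ih, map_smul, hd, smul_smul, pow_succ]
  refine ContinuousLinearMap.ext fun h => ?_
  refine tendsto_nhds_unique (tendsto_mul_of_eigen τ hz hw x y hx hy h) ?_
  have e : ∀ n, (((z * w) ^ n)⁻¹ • (τ.toCLM ^ n) (x.toOp * y.toOp)) h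
      = adjoint V.toContinuousLinearMap ((θ^[n] p : K' →L[ℂ] K') ((b : K' →L[ℂ] K')
        ((θ^[n] p : K' →L[ℂ] K') ((c : K' →L[ℂ] K') (V h))))) := fun n => by
    have hzw : (z * w) ^ n ≠ 0 := pow_ne_zero _ (mul_ne_zero (by rintro rfl; simp at hz)
      (by rintro rfl; simp at hw))
    have e1 : x.toOp * y.toOp = compression V ((b * p * c : B) : K' →L[ℂ] K') := by
      refine ContinuousLinearMap.ext fun k => ?_
      show compression V b (compression V c k)
        = adjoint V.toContinuousLinearMap ((b : K' →L[ℂ] K') ((p : K' →L[ℂ] K')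
          ((c : K' →L[ℂ] K') (V k))))
      rw [hp, hj]
      rfl
    rw [e1, ← hTn, hθ, hθ, hiter z b hb, hiter w c hc]
    have e2 : (z ^ n • b) * θ^[n] p * (w ^ n • c) = (z * w) ^ n • (b * θ^[n] p * c) := by
      rw [smul_mul_assoc, smul_mul_assoc, mul_smul_comm, smul_smul, mul_pow]
    rw [e2]
    have e3 : compression V (((z * w) ^ n • (b * θ^[n] p * c) : B) : K' →L[ℂ] K')
        = (z * w) ^ n • compression V ((b * θ^[n] p * c : B) : K' →L[ℂ] K') :=
      map_smul (compression V) _ _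
    rw [e3, smul_smul, inv_mul_cancel₀ hzw, one_smul, compression_apply]
    refine ext_inner_right ℂ fun v => ?_
    rw [adjoint_inner_left, adjoint_inner_left]
    have hs : star (θ^[n] p : K' →L[ℂ] K') = θ^[n] p :=
      congrArg Subtype.val (((hθs n p).symm.trans (congrArg θ^[n] hps)) : star (θ^[n] p) = θ^[n] p)
    conv_rhs => rw [← hs, star_eq_adjoint, adjoint_inner_left]
    have : (θ^[n] p : K' →L[ℂ] K') (V.toContinuousLinearMap v) = V.toContinuousLinearMap v := hpV n v
    rw [this]
    conv_rhs => rw [← star_eq_adjoint, hs]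
    rfl
  simp only [e]
  have h1 := hlim ((c : K' →L[ℂ] K') (V h))
  have h2 := ((b : K' →L[ℂ] K').continuous.tendsto ((c : K' →L[ℂ] K') (V h))).comp h1
  have h3 := (h2.sub_const ((b : K' →L[ℂ] K') ((c : K' →L[ℂ] K') (V h)))).norm
  rw [sub_self, norm_zero] at h3
  have h4 := squeeze_zero_norm (fun n => hple n (((b : K' →L[ℂ] K') ∘ fun n =>
    (θ^[n] p : K' →L[ℂ] K') ((c : K' →L[ℂ] K') (V h))) n
      - (b : K' →L[ℂ] K') ((c : K' →L[ℂ] K') (V h)))) h3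
  have h5 := h4.add (hlim ((b : K' →L[ℂ] K') ((c : K' →L[ℂ] K') (V h))))
  simp only [map_sub, sub_add_cancel, zero_add] at h5
  exact ((adjoint V.toContinuousLinearMap).continuous.tendsto _).comp h5

end Comparison

/-! ### Hilbert space tensor powers and the full Fock space -/

/-- A bundled complex Hilbert space, used only to run the recursion defining tensor powers. -/
structure HilbertBundle : Type (u + 1) where
  carrier : Type u
  [normed : NormedAddCommGroup carrier]
  [inner : InnerProductSpace ℂ carrier]
  [complete : CompleteSpace carrier]

attribute [instance] HilbertBundle.normed HilbertBundle.inner HilbertBundle.complete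

section Fock

open scoped TensorProduct
open UniformSpace

variable (H : Type u) [NormedAddCommGroup H] [InnerProductSpace ℂ H]

/-- `H^{⊗0}` is a one-dimensional Hilbert space (a copy of `ℂ` in the universe of `H`), and
`H^{⊗(n+1)}` is the completion of the algebraic tensor product `H ⊗ H^{⊗n}` for the inner product
`⟪a ⊗ b, c ⊗ d⟫ = ⟪a, c⟫ ⟪b, d⟫`. -/
def tensorPowerBundle : ℕ → HilbertBundle.{u}
  | 0 => ⟨EuclideanSpace ℂ PUnit.{u + 1}⟩
  | n + 1 => ⟨Completion (H ⊗[ℂ] (tensorPowerBundle n).carrier)⟩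

/-- The Hilbert space tensor power `H^{⊗n}`. -/
def HilbertTensorPower (n : ℕ) : Type u := (tensorPowerBundle H n).carrier

instance (n : ℕ) : NormedAddCommGroup (HilbertTensorPower H n) := (tensorPowerBundle H n).normed
instance (n : ℕ) : InnerProductSpace ℂ (HilbertTensorPower H n) := (tensorPowerBundle H n).inner
instance (n : ℕ) : CompleteSpace (HilbertTensorPower H n) := (tensorPowerBundle H n).complete

/-- The full Fock space `⨁_{n ≥ 0} H^{⊗n}` (Hilbert space direct sum). -/
abbrev FullFock : Type u := lp (fun n => HilbertTensorPower H n) 2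

variable {H}

/-- The unit vector `1` of `H^{⊗0} = ℂ`. -/
def vacuumVec : HilbertTensorPower H 0 := (EuclideanSpace.single PUnit.unit (1 : ℂ) :)

/-- The vacuum vector `Ω` of the full Fock space. -/
def vacuum : FullFock H := lp.single 2 0 vacuumVec

/-- The inclusion of the algebraic tensor product `H ⊗ H^{⊗n}` into `H^{⊗(n+1)}`. -/
def toSucc (n : ℕ) : H ⊗[ℂ] HilbertTensorPower H n →ₗᵢ[ℂ] HilbertTensorPower H (n + 1) :=
  (Completion.toComplₗᵢ : H ⊗[ℂ] (tensorPowerBundle H n).carrier →ₗᵢ[ℂ] _)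

lemma denseRange_toSucc (n : ℕ) : DenseRange (toSucc (H := H) n) :=
  Completion.denseRange_coe (α := H ⊗[ℂ] (tensorPowerBundle H n).carrier)

/-- `ξ ⊗ η ∈ H^{⊗(n+1)}` for `ξ ∈ H` and `η ∈ H^{⊗n}`. -/
def tcons {n : ℕ} (ξ : H) (η : HilbertTensorPower H n) : HilbertTensorPower H (n + 1) :=
  toSucc n (ξ ⊗ₜ[ℂ] η)

lemma norm_tcons {n : ℕ} (ξ : H) (η : HilbertTensorPower H n) : ‖tcons ξ η‖ = ‖ξ‖ * ‖η‖ := by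
  unfold tcons
  rw [LinearIsometry.norm_map, TensorProduct.norm_tmul]

lemma tcons_add {n : ℕ} (ξ : H) (η η' : HilbertTensorPower H n) :
    tcons ξ (η + η') = tcons ξ η + tcons ξ η' := by
  unfold tcons
  rw [TensorProduct.tmul_add, map_add]

lemma tcons_smul {n : ℕ} (c : ℂ) (ξ : H) (η : HilbertTensorPower H n) :
    tcons ξ (c • η) = c • tcons ξ η := by
  unfold tcons
  rw [TensorProduct.tmul_smul, map_smul]

/-- The components of `ξ ⊗ η`: zero in degree `0`, and `ξ ⊗ ηₙ` in degree `n + 1`. -/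
def creationFun (ξ : H) (η : ∀ n, HilbertTensorPower H n) : ∀ n, HilbertTensorPower H n
  | 0 => 0
  | n + 1 => tcons ξ (η n)

lemma hasSum_creationFun (ξ : H) (η : FullFock H) :
    HasSum (fun n => ‖creationFun ξ η n‖ ^ 2) (‖ξ‖ ^ 2 * ‖η‖ ^ 2) := by
  have h1 : HasSum (fun n => ‖η n‖ ^ 2) (‖η‖ ^ 2) := by
    simpa using! lp.hasSum_norm (p := 2) (by simp) η
  rw [← hasSum_nat_add_iff' 1]
  simp only [Finset.range_one, Finset.sum_singleton, creationFun, norm_zero, norm_tcons, mul_pow]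
  simpa using h1.mul_left (‖ξ‖ ^ 2)

lemma memℓp_creationFun (ξ : H) (η : FullFock H) : Memℓp (creationFun ξ η) 2 :=
  memℓp_gen (by simpa using! (hasSum_creationFun ξ η).summable)

/-- The left creation operator as a linear map. -/
def creationₗ (ξ : H) : FullFock H →ₗ[ℂ] FullFock H where
  toFun η := ⟨creationFun ξ η, memℓp_creationFun ξ η⟩
  map_add' η η' := by
    ext n
    cases n with
    | zero => exact (add_zero _).symm
    | succ n => exact tcons_add ξ _ _
  map_smul' c η := by
    ext n
    cases n with
    | zero => exact (smul_zero (A := HilbertTensorPower H 0) c).symm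
    | succ n => exact tcons_smul c ξ _

lemma norm_creationₗ (ξ : H) (η : FullFock H) : ‖creationₗ ξ η‖ = ‖ξ‖ * ‖η‖ := by
  have h1 : HasSum (fun n => ‖creationₗ ξ η n‖ ^ 2) (‖creationₗ ξ η‖ ^ 2) := by
    simpa using! lp.hasSum_norm (p := 2) (by simp) (creationₗ ξ η)
  have h2 := h1.unique (hasSum_creationFun ξ η)
  rw [← mul_pow] at h2
  exact (pow_left_inj₀ (norm_nonneg _) (by positivity) two_ne_zero).mp h2

/-- The left creation operator `l_ξ`, `η ↦ ξ ⊗ η`, on the full Fock space. -/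
def creation (ξ : H) : FullFock H →L[ℂ] FullFock H :=
  LinearMap.mkContinuous (creationₗ ξ) ‖ξ‖ (fun η => (norm_creationₗ ξ η).le)

lemma creation_apply_zero (ξ : H) (η : FullFock H) : creation ξ η 0 = 0 := rfl

lemma creation_apply_succ (ξ : H) (η : FullFock H) (n : ℕ) :
    creation ξ η (n + 1) = tcons ξ (η n) := rfl

lemma norm_creation_apply (ξ : H) (η : FullFock H) : ‖creation ξ η‖ = ‖ξ‖ * ‖η‖ :=
  norm_creationₗ ξ η

/-! ### Second quantization -/

/-- The tensor power `U^{⊗n}` of a unitary `U`, determined by `U^{⊗0} = 1` and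
`U^{⊗(n+1)} (ξ ⊗ η) = U ξ ⊗ U^{⊗n} η`. -/
def tensorPowerMap (U : H ≃ₗᵢ[ℂ] H) : ∀ n, HilbertTensorPower H n ≃ₗᵢ[ℂ] HilbertTensorPower H n
  | 0 => LinearIsometryEquiv.refl ℂ _
  | n + 1 =>
    (TensorProduct.congrIsometry U (tensorPowerMap U n)).toLinearEquiv.extendOfIsometry
      (toSucc n).toLinearMap (toSucc n).toLinearMap (denseRange_toSucc n) (denseRange_toSucc n)
      (fun x => by
        show ‖toSucc n (TensorProduct.congrIsometry U (tensorPowerMap U n) x)‖ = ‖toSucc n x‖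
        rw [LinearIsometry.norm_map, LinearIsometry.norm_map, LinearIsometryEquiv.norm_map])

lemma tensorPowerMap_zero (U : H ≃ₗᵢ[ℂ] H) (η : HilbertTensorPower H 0) :
    tensorPowerMap U 0 η = η := rfl

lemma tensorPowerMap_tcons (U : H ≃ₗᵢ[ℂ] H) {n : ℕ} (ξ : H) (η : HilbertTensorPower H n) :
    tensorPowerMap U (n + 1) (tcons ξ η) = tcons (U ξ) (tensorPowerMap U n η) :=
  LinearEquiv.extendOfIsometry_eq _ (toSucc n).toLinearMap (toSucc n).toLinearMap
    (denseRange_toSucc n) (denseRange_toSucc n) _ (ξ ⊗ₜ[ℂ] η)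

lemma hasSum_norm_sq (η : FullFock H) : HasSum (fun n => ‖η n‖ ^ 2) (‖η‖ ^ 2) := by
  simpa using! lp.hasSum_norm (p := 2) (by simp) η

lemma memℓp_tensorPowerMap (V : ∀ n, HilbertTensorPower H n ≃ₗᵢ[ℂ] HilbertTensorPower H n)
    (η : FullFock H) : Memℓp (fun n => V n (η n)) 2 := by
  refine memℓp_gen ?_
  have := (hasSum_norm_sq η).summable
  simpa using! this

/-- The direct sum of unitaries of the `H^{⊗n}`, acting on the full Fock space. -/
def fockDirectSum (V : ∀ n, HilbertTensorPower H n ≃ₗᵢ[ℂ] HilbertTensorPower H n) :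
    FullFock H ≃ₗᵢ[ℂ] FullFock H where
  toFun η := ⟨fun n => V n (η n), memℓp_tensorPowerMap V η⟩
  invFun η := ⟨fun n => (V n).symm (η n), memℓp_tensorPowerMap (fun n => (V n).symm) η⟩
  left_inv η := by ext n; exact (V n).symm_apply_apply _
  right_inv η := by ext n; exact (V n).apply_symm_apply _
  map_add' η η' := by ext n; exact map_add (V n) _ _
  map_smul' c η := by ext n; exact map_smul (V n) c _
  norm_map' η := by
    have h1 := hasSum_norm_sq (⟨fun n => V n (η n), memℓp_tensorPowerMap V η⟩ : FullFock H)
    have h2 : HasSum (fun n => ‖V n (η n)‖ ^ 2) (‖η‖ ^ 2) := by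
      simpa only [LinearIsometryEquiv.norm_map] using hasSum_norm_sq η
    exact (pow_left_inj₀ (norm_nonneg _) (norm_nonneg _) two_ne_zero).mp (h1.unique h2)

/-- The second quantization `Γ_U = ⨁ₙ U^{⊗n}` of a unitary `U` of `H`. -/
def secondQuantization (U : H ≃ₗᵢ[ℂ] H) : FullFock H ≃ₗᵢ[ℂ] FullFock H :=
  fockDirectSum (tensorPowerMap U)

lemma secondQuantization_apply (U : H ≃ₗᵢ[ℂ] H) (η : FullFock H) (n : ℕ) :
    secondQuantization U η n = tensorPowerMap U n (η n) := rfl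

lemma secondQuantization_vacuum (U : H ≃ₗᵢ[ℂ] H) :
    secondQuantization U (vacuum : FullFock H) = vacuum := by
  ext n
  rw [secondQuantization_apply]
  cases n with
  | zero => rfl
  | succ n =>
    have : (vacuum : FullFock H) (n + 1) = 0 := lp.single_apply_ne 2 0 _ (Nat.succ_ne_zero n)
    rw [this, map_zero]

/-- The automorphism `x ↦ Γ_U x Γ_U^*` of `B(F(H))`. -/
def conjSecondQuantization (U : H ≃ₗᵢ[ℂ] H) :
    (FullFock H →L[ℂ] FullFock H) ≃⋆ₐ[ℂ] (FullFock H →L[ℂ] FullFock H) :=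
  (secondQuantization U).conjStarAlgEquiv

end Fock

/-! ### The map `P_ω` -/

section FockUCP

/-- A linear isometry `l` of a Hilbert space satisfies `l^* l = 1`. -/
lemma star_mul_self_of_norm {K : Type u} [NormedAddCommGroup K] [InnerProductSpace ℂ K]
    [CompleteSpace K] {l : K →L[ℂ] K} (h : ∀ v, ‖l v‖ = ‖v‖) : star l * l = 1 :=
  (norm_map_iff_adjoint_comp_self l).mp h

lemma conj_map_nonneg {K : Type u} [NormedAddCommGroup K] [InnerProductSpace ℂ K]
    [CompleteSpace K] (l : K →L[ℂ] K) {n : ℕ} (M : CStarMatrix (Fin n) (Fin n) (K →L[ℂ] K))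
    (hM : 0 ≤ M) : 0 ≤ M.map (fun x => star l * x * l) := by
  let D : CStarMatrix (Fin n) (Fin n) (K →L[ℂ] K) :=
    CStarMatrix.ofMatrix (Matrix.diagonal fun _ => l)
  have hD : ∀ i j, D i j = if i = j then l else 0 := fun i j => Matrix.diagonal_apply _ _ _
  have h := star_left_conjugate_nonneg hM D
  convert h using 1
  ext1 i j
  simp [CStarMatrix.mul_apply, CStarMatrix.star_apply, hD, apply_ite star, ite_mul, mul_ite]

/-- A family of isometries `lᵢ` of `K` with positive weights `ωᵢ` of total mass `1`. -/
structure ConvexIsometries (K : Type u) [NormedAddCommGroup K] [InnerProductSpace ℂ K]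
    [CompleteSpace K] (Θ : Type v) where
  l : Θ → K →L[ℂ] K
  isom : ∀ i v, ‖l i v‖ = ‖v‖
  ω : Θ → ℝ
  pos : ∀ i, 0 < ω i
  hasSum : HasSum ω 1

namespace ConvexIsometries

variable {K : Type u} [NormedAddCommGroup K] [InnerProductSpace ℂ K] [CompleteSpace K]
variable {Θ : Type v} (C : ConvexIsometries K Θ)

lemma norm_conj_le (i : Θ) (x : K →L[ℂ] K) : ‖star (C.l i) * x * C.l i‖ ≤ ‖x‖ := by
  have hl : ‖C.l i‖ ≤ 1 := opNorm_le_bound _ zero_le_one fun v => by rw [C.isom, one_mul]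
  calc _ ≤ ‖star (C.l i)‖ * ‖x‖ * ‖C.l i‖ :=
        (norm_mul_le _ _).trans (mul_le_mul_of_nonneg_right (norm_mul_le _ _) (norm_nonneg _))
    _ ≤ 1 * ‖x‖ * 1 := by
        rw [norm_star]
        gcongr
    _ = ‖x‖ := by ring

lemma summable (x : K →L[ℂ] K) :
    Summable fun i => (C.ω i : ℂ) • (star (C.l i) * x * C.l i) := by
  refine Summable.of_norm_bounded (g := fun i => C.ω i * ‖x‖) (C.hasSum.summable.mul_right _)
    fun i => ?_
  rw [norm_smul, Complex.norm_real, Real.norm_of_nonneg (C.pos i).le]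
  exact mul_le_mul_of_nonneg_left (C.norm_conj_le i x) (C.pos i).le

/-- `x ↦ ∑ᵢ ωᵢ lᵢ^* x lᵢ` as a linear map; the series converges absolutely in norm. -/
def toLin : (K →L[ℂ] K) →ₗ[ℂ] (K →L[ℂ] K) where
  toFun x := ∑' i, (C.ω i : ℂ) • (star (C.l i) * x * C.l i)
  map_add' x y := by
    rw [← (C.summable x).tsum_add (C.summable y)]
    refine tsum_congr fun i => ?_
    rw [mul_add, add_mul, smul_add]
  map_smul' c x := by
    rw [RingHom.id_apply, ← (C.summable x).tsum_const_smul c]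
    refine tsum_congr fun i => ?_
    rw [mul_smul_comm, smul_mul_assoc, smul_comm]

lemma hasSum_toLin (x : K →L[ℂ] K) :
    HasSum (fun i => (C.ω i : ℂ) • (star (C.l i) * x * C.l i)) (C.toLin x) := (C.summable x).hasSum

lemma toLin_one : C.toLin 1 = 1 := by
  refine (C.hasSum_toLin 1).unique ?_
  have h : HasSum (fun i => (C.ω i : ℂ)) 1 := by
    simpa using C.hasSum.mapL Complex.ofRealCLM
  have h2 := h.smul_const (1 : K →L[ℂ] K)
  rw [one_smul] at h2
  refine h2.congr_fun ?_
  intro i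
  rw [mul_one, star_mul_self_of_norm (C.isom i)]

lemma toLin_map_nonneg (n : ℕ) (M : CStarMatrix (Fin n) (Fin n) (K →L[ℂ] K)) (hM : 0 ≤ M) :
    0 ≤ M.map C.toLin := by
  have h1 : Tendsto (fun s : Finset Θ => ∑ i ∈ s,
      M.map (fun x => star ((√(C.ω i) : ℂ) • C.l i) * x * ((√(C.ω i) : ℂ) • C.l i))) atTop
      (𝓝 (M.map C.toLin)) := by
    refine tendsto_pi_nhds.mpr fun a => tendsto_pi_nhds.mpr fun b => ?_
    have := C.hasSum_toLin (M a b)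
    refine Tendsto.congr (fun s => ?_) this
    have e : ∀ (f : Θ → CStarMatrix (Fin n) (Fin n) (K →L[ℂ] K)),
        (∑ i ∈ s, f i) a b = ∑ i ∈ s, f i a b := fun f => by
      classical
      induction s using Finset.induction_on with
      | empty => rfl
      | insert i s hi ih => rw [Finset.sum_insert hi, Finset.sum_insert hi, ← ih]; rfl
    rw [e]
    refine Finset.sum_congr rfl fun i _ => ?_
    rw [CStarMatrix.map_apply, star_smul, smul_mul_assoc, smul_mul_assoc, mul_smul_comm, smul_smul,
      Complex.star_def, Complex.conj_ofReal, ← Complex.ofReal_mul, Real.mul_self_sqrt (C.pos i).le]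
  exact CStarAlgebra.isClosed_nonneg.mem_of_tendsto h1 (Eventually.of_forall fun s =>
    Finset.sum_nonneg fun i _ => conj_map_nonneg _ M hM)

lemma toLin_mono {x y : K →L[ℂ] K} (h : x ≤ y) : C.toLin x ≤ C.toLin y := by
  let φ : CompletelyPositiveMap (K →L[ℂ] K) (K →L[ℂ] K) :=
    { C.toLin with map_cstarMatrix_nonneg' := C.toLin_map_nonneg }
  exact OrderHomClass.mono φ h

lemma inner_toLin (x : K →L[ℂ] K) (v w : K) :
    HasSum (fun i => (C.ω i : ℂ) * ⟪C.l i w, x (C.l i v)⟫_ℂ) ⟪w, C.toLin x v⟫_ℂ := by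
  have h1 : HasSum (fun i => ((C.ω i : ℂ) • (star (C.l i) * x * C.l i)) v) (C.toLin x v) :=
    (C.hasSum_toLin x).mapL (ContinuousLinearMap.apply ℂ K v)
  have h2 := h1.mapL (innerSL ℂ w)
  refine h2.congr_fun ?_
  intro i
  show _ = ⟪w, (C.ω i : ℂ) • (adjoint (C.l i)) (x (C.l i v))⟫_ℂ
  rw [inner_smul_right, adjoint_inner_right]

lemma toLin_normal (S : Set (K →L[ℂ] K)) (hne : S.Nonempty) (hS : DirectedOn (· ≤ ·) S)
    (a : K →L[ℂ] K) (ha : IsLUB S a) : IsLUB (C.toLin '' S) (C.toLin a) := by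
  have : Nonempty S := hne.to_subtype
  have : IsDirectedOrder S := directedOn_iff_isDirectedOrder.mp hS
  have hmono : Monotone fun s : S => (s : K →L[ℂ] K) := fun _ _ h => h
  have hle : ∀ s : S, (s : K →L[ℂ] K) ≤ a := fun s => ha.1 s.2
  obtain ⟨L, hL, hlub⟩ := exists_lub_of_monotone (fun s : S => (s : K →L[ℂ] K)) hmono a hle
  rw [Subtype.range_coe] at hlub
  obtain rfl : L = a := hlub.unique ha
  obtain ⟨L₂, hL₂, hlub₂⟩ := exists_lub_of_monotone (fun s : S => C.toLin s)
    (fun _ _ h => C.toLin_mono h) (C.toLin L) (fun s => C.toLin_mono (hle s))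
  have e : L₂ = C.toLin L := by
    refine ContinuousLinearMap.ext fun v => ext_inner_left ℂ fun w => ?_
    have h1 : Tendsto (fun s : S => ⟪w, C.toLin s v⟫_ℂ) atTop (𝓝 ⟪w, L₂ v⟫_ℂ) :=
      tendsto_const_nhds.inner (hL₂ v)
    refine tendsto_nhds_unique h1 ?_
    have s₀ : S := Classical.arbitrary S
    rw [← (C.inner_toLin L v w).tsum_eq]
    simp only [← (C.inner_toLin _ v w).tsum_eq]
    refine tendsto_tsum_of_dominated_convergence
      (bound := fun i => C.ω i * (‖w‖ * ((‖L - s₀‖ + ‖(s₀ : K →L[ℂ] K)‖) * ‖v‖)))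
      (C.hasSum.summable.mul_right _) (fun i => ?_) ?_
    · exact tendsto_const_nhds.mul (tendsto_const_nhds.inner (hL _))
    · filter_upwards [Ici_mem_atTop s₀] with s hs i
      have hn : ‖(s : K →L[ℂ] K)‖ ≤ ‖L - s₀‖ + ‖(s₀ : K →L[ℂ] K)‖ := by
        have h3 : ‖(s : K →L[ℂ] K) - s₀‖ ≤ ‖L - s₀‖ :=
          CStarAlgebra.norm_le_norm_of_nonneg_of_le (sub_nonneg.mpr hs)
            (sub_le_sub_right (hle s) _)
        calc ‖(s : K →L[ℂ] K)‖ = ‖((s : K →L[ℂ] K) - s₀) + s₀‖ := by rw [sub_add_cancel]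
          _ ≤ _ := (norm_add_le _ _).trans (add_le_add_left h3 _)
      rw [norm_mul, Complex.norm_real, Real.norm_of_nonneg (C.pos i).le]
      refine mul_le_mul_of_nonneg_left ((norm_inner_le_norm _ _).trans ?_) (C.pos i).le
      rw [C.isom]
      refine mul_le_mul_of_nonneg_left ?_ (norm_nonneg _)
      have := (s : K →L[ℂ] K).le_of_opNorm_le hn (C.l i v)
      rwa [C.isom] at this
  rw [← e]
  convert hlub₂ using 1
  ext x
  simp

/-- The normal ucp map `x ↦ ∑ᵢ ωᵢ lᵢ^* x lᵢ`. -/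
def toNormalUCPMap : NormalUCPMap K where
  toLinearMap := C.toLin
  map_cstarMatrix_nonneg' := C.toLin_map_nonneg
  map_one' := C.toLin_one
  normal' S hne hS _ a ha := C.toLin_normal S hne hS a ha

end ConvexIsometries

variable {H : Type u} [NormedAddCommGroup H] [InnerProductSpace ℂ H] {Θ : Type v}

/-- The left creation operators `l_{eᵢ}` of an orthonormal basis, with weights `ωᵢ`. -/
def fockIsometries (e : HilbertBasis Θ ℂ H) (ω : Θ → ℝ) (hpos : ∀ i, 0 < ω i) (hsum : HasSum ω 1) :
    ConvexIsometries (FullFock H) Θ where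
  l i := creation (e i)
  isom i v := by rw [norm_creation_apply, e.orthonormal.norm_eq_one, one_mul]
  ω := ω
  pos := hpos
  hasSum := hsum

/-- The normal ucp map `P_ω(x) = ∑ᵢ ωᵢ l_{eᵢ}^* x l_{eᵢ}` on `B(F(H))` attached to an orthonormal
basis `(eᵢ)` of `H` and positive weights `(ωᵢ)` with sum `1`. -/
def fockUCP (e : HilbertBasis Θ ℂ H) (ω : Θ → ℝ) (hpos : ∀ i, 0 < ω i) (hsum : HasSum ω 1) :
    NormalUCPMap (FullFock H) :=
  (fockIsometries e ω hpos hsum).toNormalUCPMap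

/-- The defining formula of `P_ω`, with convergence in norm. -/
lemma hasSum_fockUCP (e : HilbertBasis Θ ℂ H) (ω : Θ → ℝ) (hpos : ∀ i, 0 < ω i)
    (hsum : HasSum ω 1) (x : FullFock H →L[ℂ] FullFock H) :
    HasSum (fun i => (ω i : ℂ) • (star (creation (e i)) * x * creation (e i)))
      (fockUCP e ω hpos hsum x) :=
  (fockIsometries e ω hpos hsum).hasSum_toLin x

end FockUCP

end PeripheralPoisson

end

noncomputable section

namespace PeripheralPoisson

open scoped CStarAlgebra InnerProductSpace ComplexOrder Topology
open Filter ContinuousLinearMap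

/-! ### Spatially conjugate normal ucp maps -/

section Conjugation

universe u₁ u₂

variable {K : Type u₁} [NormedAddCommGroup K] [InnerProductSpace ℂ K] [CompleteSpace K]
  {K' : Type u₂} [NormedAddCommGroup K'] [InnerProductSpace ℂ K'] [CompleteSpace K']
  {τ : NormalUCPMap K} {σ : NormalUCPMap K'} (W : K ≃ₗᵢ[ℂ] K')

/-! The Fock space enters only through the covariance `Γ_U l_ξ Γ_U^* = l_{Uξ}`, which is the
identity `Γ_U (ξ ⊗ η) = Uξ ⊗ Γ_U η` in operator form (`conjSecondQuantization_creation`). Since `U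
e_i = f_i`, conjugation by `Γ_U` sends the term `ω_i l_{e_i}^* x l_{e_i}` of `P_ω(x)` to the term
with the same index and weight in `P'_ω(Γ_U x Γ_U^*)`. Both series converge in norm and conjugation
is norm continuous, so the sums agree. This is the intertwining relation
`conjSecondQuantization_fockUCP`.

The second half is a general fact: if a unitary `W : K → K'` satisfies `W τ(x) W^* = σ(W x W^*)` for
all `x`, then everything from which `P(τ)` is built is carried to the same object for `σ`.
Eigenvectors go to eigenvectors with the same eigenvalue, hence closed spans to closed spans, and
linear operations and adjoints are preserved because conjugation is a `*`-isomorphism of the full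
operator algebras.

The product needs an argument, because `x ∘ y` is not the operator product `x y`, so
multiplicativity of conjugation does not apply to it directly. It is the strong limit of `τⁿ(τ⁻ⁿ(x)
τ⁻ⁿ(y))`, where `τ⁻ⁿ` makes sense because `τ` is bijective on `P(τ)`. Conjugation commutes with
`τⁿ`, with `τ⁻ⁿ` and with the operator product, so the approximants correspond exactly for every `n`
(`approxProd_conjPeripheral`). Conjugation by a fixed unitary preserves strong limits, so the limits
correspond as well (`prodLim_conjPeripheral`). The inverse comes from the same construction applied
to `W^*`, which intertwines `σ` and `τ`. -/

lemma continuous_conjStarAlgEquiv : Continuous W.conjStarAlgEquiv :=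
  -- Conjugation by `W` as a `*`-isomorphism and as a bicontinuous algebra isomorphism are the same
  -- function by definition; the second form carries the norm continuity.
  W.toContinuousLinearEquiv.conjContinuousAlgEquiv.continuous

/-- One summand of the intertwining relation: a `*`-isomorphism acts on a Kraus term by acting on
its operator coefficient and on its argument separately. -/
lemma conjStarAlgEquiv_smul_star_mul_mul (c : ℂ) (l x : K →L[ℂ] K) :
    W.conjStarAlgEquiv (c • (star l * x * l))
      = c • (star (W.conjStarAlgEquiv l) * W.conjStarAlgEquiv x * W.conjStarAlgEquiv l) := by
  rw [map_smul, map_mul, map_mul, map_star]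

/-- The relation is symmetric: evaluate it at `W^* x W` and conjugate back. Everything proved for
`W` thereby holds for `W.symm` with `τ` and `σ` exchanged, which supplies the inverse map of
`conjBoundary`. -/
lemma intertwines_symm
    (hτσ : ∀ x, W.conjStarAlgEquiv (τ x) = σ (W.conjStarAlgEquiv x))
    (x : K' →L[ℂ] K') :
    W.symm.conjStarAlgEquiv (σ x) = τ (W.symm.conjStarAlgEquiv x) := by
  have h1 := hτσ (W.symm.conjStarAlgEquiv x)
  -- Conjugation by `W.symm` is by definition the inverse of conjugation by `W`, so the cancellation
  -- laws of the equivalence apply here and in the last line.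
  have h2 : W.conjStarAlgEquiv (W.symm.conjStarAlgEquiv x) = x :=
    W.conjStarAlgEquiv.apply_symm_apply x
  rw [h2] at h1
  rw [← h1]
  exact W.conjStarAlgEquiv.symm_apply_apply _

/-- If `τ x = z x`, then `σ (W x W^*) = W (τ x) W^* = z (W x W^*)`, so a peripheral eigenvector
stays one, for the same `z`. Linearity and norm continuity extend this to the closed span. -/
lemma conj_mem_peripheralSpace
    (hτσ : ∀ x, W.conjStarAlgEquiv (τ x) = σ (W.conjStarAlgEquiv x))
    (x : peripheralSpace τ) :
    W.conjStarAlgEquiv (x : K →L[ℂ] K) ∈ peripheralSpace σ := by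
  refine peripheral_induction τ
    (p := fun x => W.conjStarAlgEquiv (x : K →L[ℂ] K) ∈ peripheralSpace σ) ?_ ?_ ?_ ?_ x
  · exact (isClosed_peripheralSpace σ).preimage
      ((continuous_conjStarAlgEquiv W).comp continuous_subtype_val)
  · intro x y hx hy
    rw [Submodule.coe_add, map_add]
    exact Submodule.add_mem _ hx hy
  · intro c x hx
    rw [Submodule.coe_smul, map_smul]
    exact Submodule.smul_mem _ c hx
  · intro z x hz hx
    refine eigenvector_mem σ hz ?_
    rw [mem_eigenspace, ← hτσ, hx, map_smul]

lemma conj_pow_apply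
    (hτσ : ∀ x, W.conjStarAlgEquiv (τ x) = σ (W.conjStarAlgEquiv x))
    (n : ℕ) (x : K →L[ℂ] K) :
    W.conjStarAlgEquiv ((τ.toCLM ^ n) x) = (σ.toCLM ^ n) (W.conjStarAlgEquiv x) := by
  induction n with
  | zero => rfl
  | succ n ih =>
    rw [pow_succ', pow_succ']
    -- With the extra factor split off on the left, the hypothesis moves conjugation past the outer
    -- `τ`, and the induction hypothesis past the remaining `τⁿ`.
    exact (hτσ _).trans (congrArg σ ih)

/-! ### Transport of the modified Choi–Effros product -/

variable (hτσ : ∀ x, W.conjStarAlgEquiv (τ x) = σ (W.conjStarAlgEquiv x))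

/-- Conjugation by a unitary that intertwines `τ` and `σ`, as a map `P(τ) → P(σ)`. -/
def conjPeripheral (x : peripheralSpace τ) : peripheralSpace σ :=
  ⟨W.conjStarAlgEquiv (x : K →L[ℂ] K), conj_mem_peripheralSpace W hτσ x⟩

/-- The intertwining relation itself, read inside the boundary spaces. There `τ` and `σ` are
invertible, so a statement about negative powers can follow. -/
lemma shift_conjPeripheral (x : peripheralSpace τ) :
    shift σ (conjPeripheral W hτσ x) = conjPeripheral W hτσ (shift τ x) :=
  Subtype.ext (hτσ x).symm

/-- A map that commutes with two bijections commutes with their inverses. This is why the relation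
between `τ` and `σ` also controls `τ⁻ⁿ` and `σ⁻ⁿ`. -/
lemma back_conjPeripheral (n : ℕ) (x : peripheralSpace τ) :
    back σ n (conjPeripheral W hτσ x) = conjPeripheral W hτσ (back τ n x) := by
  induction n with
  | zero => rfl
  | succ n ih =>
    -- Applying `σ` lowers `σ⁻⁽ⁿ⁺¹⁾` to `σ⁻ⁿ`, where the induction hypothesis is available; nothing
    -- is lost, as `σ` is injective on `P(σ)`.
    apply (shift σ).injective
    rw [shift_back_succ, ih, shift_conjPeripheral, shift_back_succ]

/-- Inside the approximant the product is the ordinary operator product, for which conjugation is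
multiplicative; the positive and negative powers around it have been dealt with. The equality is
exact at every stage `n`, before any limit. -/
lemma approxProd_conjPeripheral (n : ℕ) (x y : peripheralSpace τ) :
    approxProd σ n (conjPeripheral W hτσ x) (conjPeripheral W hτσ y)
      = W.conjStarAlgEquiv (approxProd τ n x y) := by
  unfold approxProd
  rw [back_conjPeripheral, back_conjPeripheral, conj_pow_apply W hτσ,
    map_mul W.conjStarAlgEquiv]
  rfl

/-- The approximants converge only strongly in general, so norm continuity of conjugation is not
what is used. Instead `(W a W^*) v = W (a (W^* v))`: the limit at `v` for `σ` is the image under `W`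
of the limit at `W^* v` for `τ`. -/
lemma prodLim_conjPeripheral (x y : peripheralSpace τ) :
    prodLim σ (conjPeripheral W hτσ x) (conjPeripheral W hτσ y)
      = W.conjStarAlgEquiv (prodLim τ x y) := by
  refine prodLim_unique σ fun v => ?_
  simp only [approxProd_conjPeripheral, LinearIsometryEquiv.conjStarAlgEquiv_apply_apply]
  exact (W.continuous.tendsto _).comp (tendsto_prodLim τ x y (W.symm v))

/-- A unitary that intertwines `τ` and `σ` induces a `*`-isomorphism of their peripheral Poisson
boundaries. -/
def conjBoundary : PeripheralPoissonBoundary τ ≃⋆ₐ[ℂ] PeripheralPoissonBoundary σ where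
  toFun := conjPeripheral W hτσ
  invFun := conjPeripheral W.symm (intertwines_symm W hτσ)
  left_inv _ := Subtype.ext (W.conjStarAlgEquiv.symm_apply_apply _)
  right_inv _ := Subtype.ext (W.conjStarAlgEquiv.apply_symm_apply _)
  -- The only field that involves the dynamics: addition, scalars and adjoint are inherited from the
  -- operator algebra, while the product is the strong limit just transported.
  map_mul' x y := Subtype.ext (prodLim_conjPeripheral W hτσ x y).symm
  map_add' x y := Subtype.ext (map_add W.conjStarAlgEquiv x.toOp y.toOp)
  map_star' x := Subtype.ext (map_star W.conjStarAlgEquiv x.toOp)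
  map_smul' c x := Subtype.ext (map_smul W.conjStarAlgEquiv c x.toOp)

lemma toOp_conjBoundary (x : PeripheralPoissonBoundary τ) :
    (conjBoundary W hτσ x).toOp = W.conjStarAlgEquiv x.toOp := rfl

end Conjugation

/-! ### Second quantization intertwines `P_ω` and `P'_ω` -/

section SecondQuantization

universe u₁ u₂

variable {H : Type u₁} [NormedAddCommGroup H] [InnerProductSpace ℂ H] {Θ : Type u₂}

/-- Compared degree by degree: `l_ξ` raises the degree by one, and `U^{⊗(n+1)}` acts on `ξ ⊗ η` as
`U` on the first factor and `U^{⊗n}` on the second. -/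
lemma secondQuantization_creation (U : H ≃ₗᵢ[ℂ] H) (ξ : H) (η : FullFock H) :
    secondQuantization U (creation ξ η) = creation (U ξ) (secondQuantization U η) := by
  ext n
  cases n with
  -- A created vector has no vacuum component and `U^{⊗0}` is the identity, so both sides reduce to
  -- `0`.
  | zero => rfl
  | succ n => exact tensorPowerMap_tcons U ξ (η n)

/-- The previous identity evaluated at `Γ_U^* v`, where `Γ_U Γ_U^*` cancels. For `ξ = e_i` it turns
the operators defining `P_ω` into those defining `P'_ω`. -/
lemma conjSecondQuantization_creation (U : H ≃ₗᵢ[ℂ] H) (ξ : H) :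
    conjSecondQuantization U (creation ξ) = creation (U ξ) := by
  refine ContinuousLinearMap.ext fun v => ?_
  have h : conjSecondQuantization U (creation ξ) v
      = secondQuantization U (creation ξ ((secondQuantization U).symm v)) := rfl
  rw [h, secondQuantization_creation, LinearIsometryEquiv.apply_symm_apply]

/-- A continuous additive map may be applied to a convergent series term by term. The resulting
series has the terms that define `P'_ω` at `Γ_U x Γ_U^*`, and sums are unique. -/
lemma conjSecondQuantization_fockUCP (e f : HilbertBasis Θ ℂ H) (ω : Θ → ℝ) (hpos : ∀ i, 0 < ω i)
    (hsum : HasSum ω 1) (U : H ≃ₗᵢ[ℂ] H) (hU : ∀ i, U (e i) = f i)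
    (x : FullFock H →L[ℂ] FullFock H) :
    conjSecondQuantization U (fockUCP e ω hpos hsum x)
      = fockUCP f ω hpos hsum (conjSecondQuantization U x) := by
  have h1 := (hasSum_fockUCP e ω hpos hsum x).map (conjSecondQuantization U)
    (continuous_conjStarAlgEquiv (secondQuantization U))
  refine (h1.congr_fun fun i => ?_).unique
    (hasSum_fockUCP f ω hpos hsum (conjSecondQuantization U x))
  refine Eq.trans ?_ (conjStarAlgEquiv_smul_star_mul_mul (secondQuantization U) _ _ _).symm
  have h2 := conjSecondQuantization_creation U (e i)
  -- The only place where `U e_i = f_i` is used: it identifies the transported creation operator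
  -- with `l_{f_i}`, index by index, so that the weights match.
  rw [hU] at h2
  rw [← h2]
  rfl

end SecondQuantization

end PeripheralPoisson

end

open PeripheralPoisson in
theorem mainTheorem7 {H : Type*} [NormedAddCommGroup H] [InnerProductSpace ℂ H] [CompleteSpace H]
    {Θ : Type*} (e f : HilbertBasis Θ ℂ H) (ω : Θ → ℝ) (hpos : ∀ i, 0 < ω i) (hsum : HasSum ω 1)
    (U : H ≃ₗᵢ[ℂ] H) (hU : ∀ i, U (e i) = f i) :
    (∀ x : FullFock H →L[ℂ] FullFock H,
      conjSecondQuantization U (fockUCP e ω hpos hsum x)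
        = fockUCP f ω hpos hsum (conjSecondQuantization U x)) ∧
    ∃ φ : PeripheralPoissonBoundary (fockUCP e ω hpos hsum) ≃⋆ₐ[ℂ]
        PeripheralPoissonBoundary (fockUCP f ω hpos hsum),
      ∀ x, (φ x).toOp = conjSecondQuantization U x.toOp := by
  have h := conjSecondQuantization_fockUCP e f ω hpos hsum U hU
  -- The intertwining relation is both the first claim and the hypothesis that lets `W = Γ_U` induce
  -- the isomorphism. On underlying operators that isomorphism is conjugation by construction, so it
  -- is the restriction of `x ↦ Γ_U x Γ_U^*`.
  exact ⟨h, conjBoundary (secondQuantization U) h, toOp_conjBoundary (secondQuantization U) h⟩
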